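/- Fix $\delta>-1$. **The offspring process.** Let $(\mathscr E_{(k-1)\leadsto k})_{k\ge1}$ be random variables in $[0,\infty]$ with partial sums $\sigma_k=\sum_{i=1}^k\mathscr E_{(i-1)\leadsto i}$ (so $\sigma_0=0$) such that, for all $k\ge1$ and $s\ge0$, almost surely $$\mathbb P\big(\mathscr E_{(k-1)\leadsto k}>s\,\big|\,(\mathscr E_{(j-1)\leadsto j})_{1\le j\le k-1}\big)=\exp\Big(-\int_0^s h_{(k-1)\leadsto k}(x)\,dx\Big),$$ $$h_{(k-1)\leadsto k}(x)=\frac{1+\delta}{1+\frac12\delta}\big(1-e^{-(x+\sigma_{k-1})}\big)+\frac1{1+\frac12\delta}\sum_{j=1}^{k-1}\big(1-e^{-(\sigma_{k-1}-\sigma_j+x)}\big).$$ Let $\mathcal P_{\sf SeRi}(t)=\#\{i\ge1:\sigma_i\le t\}$, and let $\mathrm{BP}_{\sf SeRi}$ be the continuous-time branching process, started from one individual at time $0$, in which the individuals reproduce independently and each individual has its successive children at ages distributed as $\sigma_1,\sigma_2,\dots$. **The edge branching process.** Let $\mathrm{BP}_{\mathbf e}$ be the continuous-time branching process, started from one individual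 (the root) at time $0$, in which all individuals reproduce independently, the root according to a Poisson point process on $[0,\infty)$ with rate $\frac{1+\delta}{1+\frac12\delta}(1-e^{-t})$ at time $t$, and every other individual according to a Poisson point process with rate $\frac{1}{1+\frac12\delta}(1-e^{-t})$ at age $t$. Let $|\mathrm{BP}_{\mathbf e}(t)|$ be the number of individuals born up to time $t$, the root included. (Equivalently, it is a branching process with immigration: $1$ plus the sizes of the descendant processes of the immigrants, who arrive at the reproduction times of the root.) **Proposition (Equivalence).** 1. As stochastic processes, $$(\mathcal P_{\sf SeRi}(t)+1)_{t\ge0}\stackrel d=(|\mathrm{BP}_{\mathbf e}(t)|)_{t\ge0}.$$ 2. Thus, consider the continuous-time branching process, started from one individual at time $0$, in which each individual $w$ carries its own independent copy of $\mathrm{BP}_{\mathbf e}$ and has its $k$-th child, $k\ge1$, at the age at which the $k$-th birth (not counting the root) occurs in that copy. Its process of family trees (with children labelled in order of birth) has the same law as that of $\mathrm{BP}_{\sf SeRi}$. 3. Consequently, let $T_1$ be exponential with mean $1$, independent of $\mathcal P_{\sf SeRi}$, respectively of $\mathrm{BP}_{\mathbf e}$. The limiting degree $D_{\sf SeRi}=\mathcal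 P_{\sf SeRi}(T_1)+1$ satisfies $\mathbb P(D_{\sf SeRi}=k)=p_{{\sf SeRi}}(k):=\mathbb P(\sigma_{k-1}\le T_1<\sigma_k)$ for $k\ge1$, and $$D_{\sf SeRi}\stackrel d=|\mathrm{BP}_{\mathbf e}(T_1)|.$$ -/

import Mathlib

open MeasureTheory ProbabilityTheory
open scoped NNReal ENNReal

universe u v

namespace SelfReinforcement

noncomputable section

/-! ### Poisson point processes on the half-line

A point process on `[0, ∞)` is recorded by the nondecreasing sequence of its points; the value `∞`
is used when the process has run out of points. -/

/-- The number of points of the sequence `τ` that lie in `B`. -/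
def pointCount (τ : ℕ → ℝ≥0∞) (B : Set ℝ) : ℕ∞ :=
  {i : ℕ | τ i ≠ ∞ ∧ (τ i).toReal ∈ B}.encard

/-- The measure `r(t) dt` on `[0, ∞)`. -/
def intensityMeasure (r : ℝ → ℝ) : Measure ℝ :=
  (volume.restrict (Set.Ici 0)).withDensity fun t => ENNReal.ofReal (r t)

/-- `τ` is the ordered enumeration of a Poisson point process with intensity measure `Λ`:
the numbers of points in disjoint Borel sets are independent, and the number of points in a Borel
set of finite intensity `Λ B` has the Poisson distribution with mean `Λ B`. -/
structure IsPoissonPointProcess {Ω : Type*} [MeasurableSpace Ω] (τ : Ω → ℕ → ℝ≥0∞)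
    (Λ : Measure ℝ) (μ : Measure Ω) : Prop where
  measurable : Measurable τ
  monotone : ∀ᵐ ω ∂μ, Monotone (τ ω)
  indep : ∀ (n : ℕ) (B : Fin n → Set ℝ), (∀ i, MeasurableSet (B i)) →
    Pairwise (fun i j => Disjoint (B i) (B j)) →
    iIndepFun (fun i ω => pointCount (τ ω) (B i)) μ
  poisson : ∀ B : Set ℝ, MeasurableSet B → Λ B ≠ ∞ →
    HasLaw (fun ω => pointCount (τ ω) B)
      ((poissonMeasure (Λ B).toNNReal).map (fun n : ℕ => (n : ℕ∞))) μ

/-! ### Continuous-time branching processes in Ulam–Harris notation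

An individual is a finite word of natural numbers: `[]` is the root, and `i :: w` is the child
number `i` (counting from `0`, in order of birth) of the individual `w`. The age of `w` at the birth
of this child is `ξ w i`. -/

/-- The birth time of an individual; it is `∞` if the individual is never born. -/
def birthTime (ξ : List ℕ → ℕ → ℝ≥0∞) : List ℕ → ℝ≥0∞
  | [] => 0
  | i :: w => birthTime ξ w + ξ w i

/-- The family tree at time `t`: the set of all individuals born up to time `t`. -/
def population (ξ : List ℕ → ℕ → ℝ≥0∞) (t : ℝ≥0∞) : Set (List ℕ) :=
  {w | birthTime ξ w ≤ t}

/-- The number of individuals born up to time `t`, the root included. -/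
def populationSize (ξ : List ℕ → ℕ → ℝ≥0∞) (t : ℝ≥0∞) : ℕ∞ :=
  (population ξ t).encard

/-- The time of the birth number `k + 1` in the whole population, the root not being counted:
the first time at which there are at least `k + 2` individuals, the root included. -/
def successiveBirthTime (ξ : List ℕ → ℕ → ℝ≥0∞) (k : ℕ) : ℝ≥0∞ :=
  sInf {t : ℝ≥0∞ | (k : ℕ∞) + 2 ≤ populationSize ξ t}

/-! ### The self-reinforced offspring process -/

/-- `arrivalTime e k = σ_k = e 0 + ... + e (k - 1)`, where `e j` is the time that is needed to go
from `j` to `j + 1` children. -/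
def arrivalTime (e : ℕ → ℝ≥0∞) (k : ℕ) : ℝ≥0∞ :=
  ∑ i ∈ Finset.range k, e i

/-- The hazard rate of the time to go from `k` to `k + 1` children, at time `x` after the birth of
child number `k`, when the children `1, ..., k` were born at the times `σ 1, ..., σ k`
(and `σ 0 = 0`). -/
def hazardRate (δ : ℝ) (σ : ℕ → ℝ) (k : ℕ) (x : ℝ) : ℝ :=
  (1 + δ) / (1 + δ / 2) * (1 - Real.exp (-(x + σ k))) +
    1 / (1 + δ / 2) * ∑ j ∈ Finset.Icc 1 k, (1 - Real.exp (-(σ k - σ j + x)))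

/-- `E` is the sequence of inter-arrival times of the self-reinforced offspring process with
parameter `δ`: given the first `k` inter-arrival times, the next one has hazard rate
`hazardRate δ σ k`. -/
structure IsSelfReinforcedInterarrival {Ω : Type*} [MeasurableSpace Ω] (δ : ℝ)
    (E : Ω → ℕ → ℝ≥0∞) (μ : Measure Ω) : Prop where
  measurable : Measurable E
  hazard : ∀ (k : ℕ) (s : ℝ≥0),
    μ⟦{ω | (s : ℝ≥0∞) < E ω k} |
        MeasurableSpace.comap (fun ω (j : Fin k) => E ω j) inferInstance⟧
      =ᵐ[μ] fun ω =>
        Real.exp (-∫ x in (0 : ℝ)..s, hazardRate δ (fun j => (arrivalTime (E ω) j).toReal) k x)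

/-- The number of children at time `t`, `#{i ≥ 1 : σ_i ≤ t}`. -/
def offspringCount (e : ℕ → ℝ≥0∞) (t : ℝ≥0) : ℕ∞ :=
  {i : ℕ | 1 ≤ i ∧ arrivalTime e i ≤ t}.encard

/-- The individuals reproduce independently of each other, each according to the self-reinforced
offspring process; `E ω w` are the inter-arrival times of the children of `w`. -/
structure IsSelfReinforcedBranching {Ω : Type*} [MeasurableSpace Ω] (δ : ℝ)
    (E : Ω → List ℕ → ℕ → ℝ≥0∞) (μ : Measure Ω) : Prop where
  offspring : ∀ w, IsSelfReinforcedInterarrival δ (fun ω => E ω w) μ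
  indep : iIndepFun (fun w ω => E ω w) μ

/-- The family tree at time `t` of the branching process in which the children of `w` are born at
the ages `σ_1, σ_2, ...` of `w` with inter-arrival times `e w`. -/
def selfReinforcedTree (e : List ℕ → ℕ → ℝ≥0∞) (t : ℝ≥0) : Set (List ℕ) :=
  population (fun w k => arrivalTime (e w) (k + 1)) t

/-! ### The edge branching process -/

/-- The reproduction rate of the root of the edge branching process. -/
def rootRate (δ : ℝ) (t : ℝ) : ℝ := (1 + δ) / (1 + δ / 2) * (1 - Real.exp (-t))

/-- The reproduction rate at age `t` of the other individuals of the edge branching process. -/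
def edgeRate (δ : ℝ) (t : ℝ) : ℝ := 1 / (1 + δ / 2) * (1 - Real.exp (-t))

/-- `ξ` describes the edge branching process: all individuals reproduce independently, the root
according to a Poisson process with rate `rootRate δ`, and every other individual (in terms of its
age) according to a Poisson process with rate `edgeRate δ`. -/
structure IsEdgeBranching {Ω : Type*} [MeasurableSpace Ω] (δ : ℝ)
    (ξ : Ω → List ℕ → ℕ → ℝ≥0∞) (μ : Measure Ω) : Prop where
  root : IsPoissonPointProcess (fun ω => ξ ω []) (intensityMeasure (rootRate δ)) μ
  nonroot : ∀ w, w ≠ [] →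
    IsPoissonPointProcess (fun ω => ξ ω w) (intensityMeasure (edgeRate δ)) μ
  indep : iIndepFun (fun w ω => ξ ω w) μ

/-- The family tree at time `t` of the branching process in which the ages of `w` at the births of
its children are the successive birth times in the branching process that is given by `η w`. -/
def nestedTree (η : List ℕ → List ℕ → ℕ → ℝ≥0∞) (t : ℝ≥0) : Set (List ℕ) :=
  population (fun w k => successiveBirthTime (η w) k) t

lemma birthTime_append (ξ : List ℕ → ℕ → ℝ≥0∞) (i : ℕ) (w : List ℕ) :
    birthTime ξ (w ++ [i]) = ξ [] i + birthTime (fun v => ξ (v ++ [i])) w := by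
  induction w with
  | nil => simp [birthTime]
  | cons j w ih => simp [birthTime, ih, add_assoc]

/-- The description through immigration: the root is alone at the start, immigrants enter at the
reproduction times `θ_i = ξ [] i` of the root, and each immigrant founds the branching process of
its own descendants. -/
lemma populationSize_eq_immigration (ξ : List ℕ → ℕ → ℝ≥0∞) (t : ℝ≥0) :
    (populationSize ξ t : ℝ≥0∞) = 1 + ∑' i : {i : ℕ // ξ [] i ≤ t},
      (populationSize (fun w => ξ (w ++ [(i : ℕ)])) (t - ξ [] i) : ℝ≥0∞) := by
  have key : population ξ t = {[]} ∪ ⋃ i : {i : ℕ // ξ [] i ≤ t},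
      (fun w => w ++ [(i : ℕ)]) '' population (fun w => ξ (w ++ [(i : ℕ)])) (t - ξ [] i) := by
    ext w
    rcases List.eq_nil_or_concat w with rfl | ⟨v, i, rfl⟩
    · simp [population, birthTime]
    · have h : birthTime ξ (v ++ [i]) ≤ t ↔
          ξ [] i ≤ t ∧ birthTime (fun v => ξ (v ++ [i])) v ≤ t - ξ [] i := by
        rw [birthTime_append]
        constructor
        · intro h
          have h1 : ξ [] i ≤ t := le_self_add.trans h
          exact ⟨h1, ENNReal.le_sub_of_add_le_left (ne_top_of_le_ne_top ENNReal.coe_ne_top h1) h⟩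
        · rintro ⟨h1, h2⟩
          exact (add_le_add_right h2 _).trans (add_tsub_cancel_of_le h1).le
      simp [population, h, and_comm]
  unfold populationSize
  rw [key, Set.encard_union_eq, Set.encard_singleton]
  · rw [ENat.toENNReal_add, ENat.toENNReal_one]
    congr 1
    let _ : MeasurableSpace (List ℕ) := ⊤
    rw [← Measure.count_apply MeasurableSpace.measurableSet_top, measure_iUnion]
    · refine tsum_congr fun i => ?_
      rw [Measure.count_apply MeasurableSpace.measurableSet_top,
        Function.Injective.encard_image (List.append_left_injective _)]
    · intro i j hij
      refine Set.disjoint_left.2 ?_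
      rintro _ ⟨a, -, rfl⟩ ⟨b, -, hb⟩
      apply hij
      have := List.append_inj_right' hb rfl
      ext
      simpa using this.symm
    · exact fun _ => MeasurableSpace.measurableSet_top
  · simp

end

end SelfReinforcement

open SelfReinforcement

namespace SelfReinforcement

open Filter Topology

noncomputable section

/-! If the first `k` births of the edge branching process occur at `σ 1 ≤ ... ≤ σ k`, then at time
`σ k + x` the root reproduces at rate `rootRate δ (σ k + x)` and the individual born at `σ j` at
rate `edgeRate δ (σ k - σ j + x)`. The sum of these rates is exactly `hazardRate δ σ k x`, so both
counting processes jump with the same conditional intensity. The proof makes this rigorous without a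
Markov property of the branching process, by comparing the Laplace functionals `E exp(-∑ f(birth
times))`.

For the edge branching process, the Poisson formula at the root and the independence of the subtrees
give `exp(-f 0) * exp(-∫ (1 - q u) rootRate u du)` (`lintegral_expNeg_tsum_birthTime`). Here `q =
laplaceLimit` is the functional of a non-root individual born at time `s`, and it solves `q s =
exp(-f s) * exp(-∫ (1 - q (s + u)) edgeRate u du)` (`laplaceLimit_eq`).

For the offspring process, let `M n = laplaceState ... n` be the product of `exp(-f)` over the
points up to `σ n` and of the factor that predicts all later births through `q`. The equation for
`q` (`laplaceState_glue`) and a thinning identity (`lintegral_law_thinning`) show that the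
expectation of `M n` does not depend on `n` (`lintegral_laplaceState`). At `n = 0` it is the
expression above, and `M n` tends to `exp(-∑ f (σ i))`.

Weighted counts at finitely many times are admissible `f`, and Laplace transforms determine the laws
of count vectors by Stone–Weierstrass; this gives equality of the processes. The ages at births are
measurable functionals of the counting process, which gives the family trees, and integrating over
an independent time gives the limiting degree. -/

/-! ### The map `x ↦ e ^ (-x)` on `[0, ∞]` -/

/-- The map `x ↦ e ^ (-x)` from `[0, ∞]` to `[0, 1]`. -/
def expNeg (x : ℝ≥0∞) : ℝ≥0∞ := EReal.exp (-(x : EReal))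

@[simp] lemma expNeg_zero : expNeg 0 = 1 := by simp [expNeg]

@[simp] lemma expNeg_top : expNeg ∞ = 0 := by simp [expNeg]

lemma expNeg_antitone : Antitone expNeg := fun x y h => by
  simpa [expNeg, EReal.neg_le_neg_iff] using h

lemma expNeg_le_one (x : ℝ≥0∞) : expNeg x ≤ 1 := by
  simpa using expNeg_antitone (zero_le (a := x))

lemma expNeg_ne_top (x : ℝ≥0∞) : expNeg x ≠ ∞ :=
  ne_top_of_le_ne_top ENNReal.one_ne_top (expNeg_le_one x)

lemma expNeg_injective : Function.Injective expNeg := fun x y h => by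
  simpa [expNeg, EReal.exp_strictMono.injective.eq_iff] using h

lemma continuous_expNeg : Continuous expNeg :=
  ENNReal.continuous_exp.comp (continuous_neg.comp continuous_coe_ennreal_ereal)

lemma measurable_expNeg : Measurable expNeg := continuous_expNeg.measurable

lemma expNeg_add (x y : ℝ≥0∞) : expNeg (x + y) = expNeg x * expNeg y := by
  rw [expNeg, expNeg, expNeg, ← EReal.exp_add, EReal.coe_ennreal_add, EReal.neg_add,
    sub_eq_add_neg]
  · exact Or.inl (EReal.coe_ennreal_ne_bot x)
  · exact Or.inr (EReal.coe_ennreal_ne_bot y)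

lemma expNeg_sum {ι : Type*} (s : Finset ι) (a : ι → ℝ≥0∞) :
    expNeg (∑ i ∈ s, a i) = ∏ i ∈ s, expNeg (a i) := by
  classical
  induction s using Finset.induction_on with
  | empty => simp
  | insert i s hi ih => rw [Finset.sum_insert hi, Finset.prod_insert hi, expNeg_add, ih]

lemma expNeg_nat_mul (n : ℕ) (x : ℝ≥0∞) : expNeg (n * x) = expNeg x ^ n := by
  have := expNeg_sum (Finset.range n) (fun _ => x)
  simpa using this

lemma expNeg_ofReal {x : ℝ} (hx : 0 ≤ x) :
    expNeg (ENNReal.ofReal x) = ENNReal.ofReal (Real.exp (-x)) := by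
  rw [expNeg, EReal.coe_ennreal_ofReal, max_eq_left hx, ← EReal.coe_neg, EReal.exp_coe]

/-- Sums in `[0, ∞]` always converge and `expNeg` is continuous at `∞` as well, so no finiteness is
needed. This reduces statements about infinitely many children to finite products. -/
lemma tendsto_expNeg_sum_range (a : ℕ → ℝ≥0∞) :
    Tendsto (fun n => ∏ i ∈ Finset.range n, expNeg (a i)) atTop (𝓝 (expNeg (∑' i, a i))) := by
  simp_rw [← expNeg_sum]
  exact (continuous_expNeg.tendsto _).comp ENNReal.summable.hasSum.tendsto_sum_nat

/-- The map `y ↦ - log y` from `[0, 1]` to `[0, ∞]`. -/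
def negLog (y : ℝ≥0∞) : ℝ≥0∞ := (-(ENNReal.log y)).toENNReal

/-- Lets a product of factors in `[0, 1]` over the points of a process be read as `expNeg` of a sum,
the form to which the Laplace functional applies. -/
lemma expNeg_negLog {y : ℝ≥0∞} (hy : y ≤ 1) : expNeg (negLog y) = y := by
  have : 0 ≤ -(ENNReal.log y) := by
    rw [EReal.le_neg, neg_zero]
    simpa using hy
  rw [expNeg, negLog, EReal.coe_toENNReal this, neg_neg, ENNReal.exp_log]

@[simp] lemma negLog_one : negLog 1 = 0 := by simp [negLog]

lemma measurable_negLog : Measurable negLog :=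
  (continuous_neg.measurable.comp ENNReal.measurable_log).ereal_toENNReal

/-! ### The Laplace functional of a Poisson point process -/

/-- The generating function of the Poisson law at `p = exp(-a)`, from the exponential series in `r *
p`. The value `a = ∞` corresponds to `p = 0`. -/
lemma lintegral_expNeg_poissonMeasure (r : ℝ≥0) (a : ℝ≥0∞) :
    ∫⁻ n : ℕ, expNeg (a * n) ∂(poissonMeasure r) = expNeg (r * (1 - expNeg a)) := by
  set p : ℝ := (expNeg a).toReal with hp
  have hp0 : 0 ≤ p := ENNReal.toReal_nonneg
  have hp1 : p ≤ 1 := ENNReal.toReal_le_of_le_ofReal zero_le_one (by simpa using expNeg_le_one a)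
  have hpa : expNeg a = ENNReal.ofReal p := (ENNReal.ofReal_toReal (expNeg_ne_top a)).symm
  have hs : HasSum (fun n : ℕ => Real.exp (-r) * (r * p) ^ n / (n.factorial : ℝ))
      (Real.exp (-(r * (1 - p)))) := by
    have := (NormedSpace.expSeries_div_hasSum_exp ((r : ℝ) * p)).mul_left (Real.exp (-r))
    convert! this using 1
    · simp_rw [mul_div_assoc]
    · rw [← Real.exp_eq_exp_ℝ, ← Real.exp_add]
      ring_nf
  have h1 : (r : ℝ≥0∞) * (1 - expNeg a) = ENNReal.ofReal (r * (1 - p)) := by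
    rw [ENNReal.ofReal_mul r.coe_nonneg, ENNReal.ofReal_sub _ hp0, ENNReal.ofReal_one, ← hpa,
      ENNReal.ofReal_coe_nnreal]
  rw [h1, expNeg_ofReal (mul_nonneg r.coe_nonneg (by linarith)), ← hs.tsum_eq,
    ENNReal.ofReal_tsum_of_nonneg (fun n => by positivity) hs.summable, poissonMeasure,
    lintegral_sum_measure]
  refine tsum_congr fun n => ?_
  rw [lintegral_smul_measure, lintegral_dirac, mul_comm a, expNeg_nat_mul, hpa, smul_eq_mul,
    ← ENNReal.ofReal_pow hp0, ← ENNReal.ofReal_mul (by positivity)]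
  congr 1
  rw [mul_pow]
  ring

lemma pointCount_eq_tsum (τ : ℕ → ℝ≥0∞) (B : Set ℝ) :
    (pointCount τ B : ℝ≥0∞) =
      ∑' k, {x : ℝ≥0∞ | x ≠ ∞ ∧ x.toReal ∈ B}.indicator 1 (τ k) := by
  rw [pointCount, ← ENNReal.tsum_set_one, tsum_subtype _ (fun _ => (1 : ℝ≥0∞))]
  rfl

lemma measurableSet_finite_points {B : Set ℝ} (hB : MeasurableSet B) :
    MeasurableSet {x : ℝ≥0∞ | x ≠ ∞ ∧ x.toReal ∈ B} :=
  (measurableSet_singleton ∞).compl.inter (ENNReal.measurable_toReal hB)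

lemma measurable_pointCount {B : Set ℝ} (hB : MeasurableSet B) :
    Measurable fun τ : ℕ → ℝ≥0∞ => (pointCount τ B : ℝ≥0∞) := by
  simp_rw [pointCount_eq_tsum]
  exact Measurable.tsum fun k =>
    (measurable_one.indicator (measurableSet_finite_points hB)).comp (measurable_pi_apply k)

section PoissonPointProcess

variable {Ω : Type*} [MeasurableSpace Ω] {μ : Measure Ω}

namespace IsPoissonPointProcess

variable {τ : Ω → ℕ → ℝ≥0∞} {Λ : Measure ℝ}

lemma lintegral_expNeg_mul_pointCount (h : IsPoissonPointProcess τ Λ μ) {B : Set ℝ}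
    (hB : MeasurableSet B) (hΛ : Λ B ≠ ∞) (a : ℝ≥0∞) :
    ∫⁻ ω, expNeg (a * pointCount (τ ω) B) ∂μ = expNeg ((1 - expNeg a) * Λ B) := by
  have h1 := h.poisson B hB hΛ
  rw [h1.lintegral_comp (f := fun n : ℕ∞ => expNeg (a * n)) Measurable.of_discrete.aemeasurable,
    lintegral_map Measurable.of_discrete Measurable.of_discrete]
  simp only [ENat.toENNReal_coe]
  rw [lintegral_expNeg_poissonMeasure, ENNReal.coe_toNNReal hΛ, mul_comm]

lemma lintegral_expNeg_sum_pointCount (h : IsPoissonPointProcess τ Λ μ) {ι : Type*} (s : Finset ι)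
    (B : ι → Set ℝ) (hB : ∀ i ∈ s, MeasurableSet (B i)) (hΛ : ∀ i ∈ s, Λ (B i) ≠ ∞)
    (hd : (s : Set ι).PairwiseDisjoint B) (a : ι → ℝ≥0∞) :
    ∫⁻ ω, expNeg (∑ i ∈ s, a i * pointCount (τ ω) (B i)) ∂μ =
      expNeg (∑ i ∈ s, (1 - expNeg (a i)) * Λ (B i)) := by
  -- Independence is available for families indexed by `Fin n`, so the finite set `s` is enumerated.
  have hind := h.indep s.card (fun j => B (s.equivFin.symm j))
    (fun j => hB _ (s.equivFin.symm j).2) (fun i j hij => hd (s.equivFin.symm i).2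
      (s.equivFin.symm j).2 fun hc => hij (s.equivFin.symm.injective (Subtype.ext hc)))
  have hsum : ∀ F : ι → ℝ≥0∞, ∑ i ∈ s, F i = ∑ j, F (s.equivFin.symm j) := fun F => by
    rw [← Finset.sum_coe_sort, ← Equiv.sum_comp s.equivFin.symm]
  have hind2 : iIndepFun (fun j ω => expNeg (a (s.equivFin.symm j) *
      pointCount (τ ω) (B (s.equivFin.symm j)))) μ :=
    hind.comp (fun j (n : ℕ∞) => expNeg (a (s.equivFin.symm j) * n))
      fun j => Measurable.of_discrete
  simp_rw [hsum, expNeg_sum]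
  rw [lintegral_prod_eq_prod_lintegral_of_indepFun _ _ hind2]
  · exact Finset.prod_congr rfl fun j _ => h.lintegral_expNeg_mul_pointCount
      (hB _ (s.equivFin.symm j).2) (hΛ _ (s.equivFin.symm j).2) _
  · exact fun j => measurable_expNeg.comp (((measurable_pointCount
      (hB _ (s.equivFin.symm j).2)).comp h.measurable).const_mul _)

/-- The extension by `0` at `∞` of a function on the half-line. -/
def extendZero (ψ : ℝ → ℝ≥0∞) (x : ℝ≥0∞) : ℝ≥0∞ := ({∞}ᶜ : Set ℝ≥0∞).indicator (fun x => ψ x.toReal) x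

lemma measurable_extendZero {ψ : ℝ → ℝ≥0∞} (hψ : Measurable ψ) : Measurable (extendZero ψ) :=
  (hψ.comp ENNReal.measurable_toReal).indicator (measurableSet_singleton ∞).compl

/-- The sum of `ψ` over the points is the sum of `a` times the number of points in the level set of
`a`, and these counts are independent Poisson variables. The value `0` is left out because its level
set may have infinite intensity. -/
lemma lintegral_expNeg_simpleFunc (h : IsPoissonPointProcess τ Λ μ) (ψ : SimpleFunc ℝ ℝ≥0∞)
    (hψ : ∀ a, a ≠ 0 → Λ (ψ ⁻¹' {a}) ≠ ∞) :
    ∫⁻ ω, expNeg (∑' k, extendZero ψ (τ ω k)) ∂μ = expNeg (∫⁻ t, (1 - expNeg (ψ t)) ∂Λ) := by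
  set s := ψ.range.filter (· ≠ 0) with hs
  -- Used twice: with `F = id` for the sum over the points, and with `F a = 1 - expNeg a` for the
  -- exponent.
  have hval : ∀ (t : ℝ) (F : ℝ≥0∞ → ℝ≥0∞), F 0 = 0 →
      F (ψ t) = ∑ a ∈ s, F a * (ψ ⁻¹' {a}).indicator 1 t := by
    intro t F hF
    by_cases h0 : ψ t = 0
    · rw [h0, hF, Finset.sum_eq_zero]
      intro a ha
      have : t ∉ ψ ⁻¹' {a} := by
        rintro rfl
        exact (Finset.mem_filter.1 ha).2 h0
      simp [this]
    · rw [Finset.sum_eq_single (ψ t)]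
      · simp
      · intro a _ hne
        have : t ∉ ψ ⁻¹' {a} := fun hc => hne (by simpa using hc.symm)
        simp [this]
      · intro hc
        exact absurd (Finset.mem_filter.2 ⟨ψ.mem_range_self t, h0⟩) hc
  have h1 : ∀ ω, ∑' k, extendZero ψ (τ ω k) =
      ∑ a ∈ s, a * pointCount (τ ω) (ψ ⁻¹' {a}) := by
    intro ω
    simp_rw [pointCount_eq_tsum, ← ENNReal.tsum_mul_left]
    rw [← Summable.tsum_finsetSum fun _ _ => ENNReal.summable]
    refine tsum_congr fun k => ?_
    by_cases hk : τ ω k = ∞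
    · simp [extendZero, hk]
    · simp only [extendZero, Set.mem_compl_iff, Set.mem_singleton_iff, hk, not_false_eq_true,
        Set.indicator_of_mem]
      refine (hval _ id rfl).trans ?_
      refine Finset.sum_congr rfl fun a _ => congrArg (a * ·) ?_
      classical
      simp [Set.indicator_apply, hk]
  simp_rw [h1]
  have h3 := h.lintegral_expNeg_sum_pointCount s (fun a => ψ ⁻¹' {a})
    (fun a _ => ψ.measurableSet_fiber a) (fun a ha => hψ a (Finset.mem_filter.1 ha).2)
    (fun a _ b _ hab => Set.disjoint_left.2 fun t ht ht' => hab (by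
      rw [← Set.mem_singleton_iff.1 ht, ← Set.mem_singleton_iff.1 ht'])) id
  simp only [id] at h3
  rw [h3]
  congr 1
  have h2 : ∀ t, 1 - expNeg (ψ t) = ∑ a ∈ s, (1 - expNeg a) * (ψ ⁻¹' {a}).indicator 1 t :=
    fun t => hval t (fun a => 1 - expNeg a) (by simp)
  simp_rw [h2]
  rw [lintegral_finsetSum]
  · refine Finset.sum_congr rfl fun a _ => ?_
    rw [lintegral_const_mul _ (measurable_one.indicator (ψ.measurableSet_fiber a)),
      lintegral_indicator_one (ψ.measurableSet_fiber a)]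
  · exact fun a _ => (measurable_one.indicator (ψ.measurableSet_fiber a)).const_mul _

/-- The Laplace functional of a Poisson point process. -/
theorem lintegral_expNeg_tsum [IsProbabilityMeasure μ] [SigmaFinite Λ]
    (h : IsPoissonPointProcess τ Λ μ) {φ : ℝ≥0∞ → ℝ≥0∞} (hφ : Measurable φ) (hφ0 : φ ∞ = 0) :
    ∫⁻ ω, expNeg (∑' k, φ (τ ω k)) ∂μ =
      expNeg (∫⁻ t, (1 - expNeg (φ (ENNReal.ofReal t))) ∂Λ) := by
  set φ' : ℝ → ℝ≥0∞ := fun t => φ (ENNReal.ofReal t) with hφ'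
  have hφ'm : Measurable φ' := hφ.comp ENNReal.measurable_ofReal
  -- Restricting the approximations to the spanning sets gives their nonzero level sets finite
  -- intensity.
  set ψ : ℕ → SimpleFunc ℝ ℝ≥0∞ := fun n =>
    (SimpleFunc.eapprox φ' n).restrict (spanningSets Λ n) with hψ
  have hval : ∀ n t, ψ n t = (spanningSets Λ n).indicator (SimpleFunc.eapprox φ' n) t := fun n t =>
    SimpleFunc.restrict_apply _ (measurableSet_spanningSets Λ n) t
  have hmono : Monotone fun n t => ψ n t := by
    intro m n hmn t
    simp only [hval]
    refine (Set.indicator_le_indicator_of_subset (monotone_spanningSets Λ hmn)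
      (fun _ => zero_le) t).trans ?_
    exact Set.indicator_le_indicator (SimpleFunc.monotone_eapprox φ' hmn t)
  have hlim : ∀ t, Tendsto (fun n => ψ n t) atTop (𝓝 (φ' t)) := by
    intro t
    have h1 := SimpleFunc.tendsto_eapprox hφ'm t
    refine h1.congr' ?_
    obtain ⟨N, hN⟩ := Set.mem_iUnion.1 (iUnion_spanningSets Λ ▸ Set.mem_univ t)
    filter_upwards [eventually_ge_atTop N] with n hn
    rw [hval, Set.indicator_of_mem (monotone_spanningSets Λ hn hN)]
  have hfin : ∀ n a, a ≠ 0 → Λ (ψ n ⁻¹' {a}) ≠ ∞ := by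
    intro n a ha
    refine ne_top_of_le_ne_top (measure_spanningSets_lt_top Λ n).ne (measure_mono fun t ht => ?_)
    by_contra hc
    apply ha
    rw [← Set.mem_singleton_iff.1 ht, hval, Set.indicator_of_notMem hc]
  have key := fun n => h.lintegral_expNeg_simpleFunc (ψ n) (hfin n)
  have hL : Tendsto (fun n => ∫⁻ ω, expNeg (∑' k, extendZero (ψ n) (τ ω k)) ∂μ) atTop
      (𝓝 (∫⁻ ω, expNeg (∑' k, φ (τ ω k)) ∂μ)) := by
    refine tendsto_lintegral_of_dominated_convergence (fun _ => 1) (fun n => ?_)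
      (fun n => ae_of_all _ fun ω => expNeg_le_one _) (by simp) (ae_of_all _ fun ω => ?_)
    · exact measurable_expNeg.comp (Measurable.tsum fun k =>
        (measurable_extendZero (ψ n).measurable).comp
          ((measurable_pi_apply k).comp h.measurable))
    · refine (continuous_expNeg.tendsto _).comp ?_
      have hpt : ∀ k, Tendsto (fun n => extendZero (ψ n) (τ ω k)) atTop (𝓝 (φ (τ ω k))) := by
        intro k
        by_cases hk : τ ω k = ∞
        · simp [extendZero, hk, hφ0]
        · have := hlim (τ ω k).toReal
          simpa [extendZero, hk, hφ', ENNReal.ofReal_toReal hk] using this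
      have hmk : ∀ k, Monotone fun n => extendZero (ψ n) (τ ω k) := by
        intro k m n hmn
        exact Set.indicator_le_indicator (hmono hmn _)
      simp_rw [← lintegral_count]
      exact lintegral_tendsto_of_tendsto_of_monotone (fun n => Measurable.of_discrete.aemeasurable)
        (ae_of_all _ hmk) (ae_of_all _ hpt)
  have hR : Tendsto (fun n => expNeg (∫⁻ t, (1 - expNeg (ψ n t)) ∂Λ)) atTop
      (𝓝 (expNeg (∫⁻ t, (1 - expNeg (φ' t)) ∂Λ))) := by
    refine (continuous_expNeg.tendsto _).comp ?_
    refine lintegral_tendsto_of_tendsto_of_monotone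
      (fun n => (measurable_const.sub (measurable_expNeg.comp (ψ n).measurable)).aemeasurable)
      (ae_of_all _ fun t m n hmn => ?_) (ae_of_all _ fun t => ?_)
    · exact tsub_le_tsub_left (expNeg_antitone (hmono hmn t)) _
    · exact ENNReal.Tendsto.sub tendsto_const_nhds ((continuous_expNeg.tendsto _).comp (hlim t))
        (Or.inl ENNReal.one_ne_top)
  simp_rw [key] at hL
  exact tendsto_nhds_unique hL hR

end IsPoissonPointProcess

end PoissonPointProcess

/-! ### Independence of blocks -/

section Independence

variable {Ω ι : Type*} {𝓧 : ι → Type*} [∀ i, MeasurableSpace (𝓧 i)] {X : (i : ι) → Ω → 𝓧 i}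

lemma comap_pi_le {γ : Type*} (c : γ → ι) :
    MeasurableSpace.comap (fun ω x => X (c x) ω) MeasurableSpace.pi ≤
      ⨆ i ∈ Set.range c, MeasurableSpace.comap (X i) inferInstance := by
  rw [MeasurableSpace.pi, MeasurableSpace.comap_iSup]
  refine iSup_le fun x => ?_
  rw [MeasurableSpace.comap_comp]
  exact le_iSup₂_of_le (f := fun i (_ : i ∈ Set.range c) =>
    MeasurableSpace.comap (X i) inferInstance) (c x) ⟨x, rfl⟩ le_rfl

variable [MeasurableSpace Ω] {μ : Measure Ω}

lemma _root_.ProbabilityTheory.iIndepFun.indepFun_of_disjoint (h : iIndepFun X μ)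
    (hX : ∀ i, Measurable (X i)) {α β : Type*} (a : α → ι) (b : β → ι)
    (hab : ∀ x y, a x ≠ b y) :
    IndepFun (fun ω x => X (a x) ω) (fun ω y => X (b y) ω) μ := by
  have key := indep_iSup_of_disjoint (fun i => (hX i).comap_le) h
    (S := Set.range a) (T := Set.range b)
    (by rw [Set.disjoint_left]; rintro _ ⟨x, rfl⟩ ⟨y, hy⟩; exact hab x y hy.symm)
  exact indep_of_indep_of_le_left (indep_of_indep_of_le_right key (comap_pi_le b)) (comap_pi_le a)

/-- Independence says that the joint law is a product measure, and currying turns a product over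
pairs into a product over `k` of products over the block of `k`. -/
lemma _root_.ProbabilityTheory.iIndepFun.curry {κ : Type*} {α : κ → Type*}
    {𝓨 : Type*} [MeasurableSpace 𝓨] {Y : ι → Ω → 𝓨}
    (h : iIndepFun Y μ) (hY : ∀ i, Measurable (Y i))
    (a : (k : κ) → α k → ι) (ha : Function.Injective fun p : (k : κ) × α k => a p.1 p.2) :
    iIndepFun (fun k ω x => Y (a k x) ω) μ := by
  have := h.isProbabilityMeasure
  have hp : ∀ i, IsProbabilityMeasure (μ.map (Y i)) :=
    fun i => Measure.isProbabilityMeasure_map (hY i).aemeasurable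
  have h1 := h.precomp ha
  rw [iIndepFun_iff_map_fun_eq_infinitePi_map (fun _ => hY _)] at h1
  rw [iIndepFun_iff_map_fun_eq_infinitePi_map (fun _ => by fun_prop)]
  have h2 : (fun ω (k : κ) (x : α k) => Y (a k x) ω) =
      (MeasurableEquiv.piCurry fun (k : κ) (_ : α k) => 𝓨) ∘
        (fun ω (p : (k : κ) × α k) => Y (a p.1 p.2) ω) := by
    ext; simp [Sigma.curry]
  have h3 : ∀ k, μ.map (fun ω x => Y (a k x) ω) =
      Measure.infinitePi fun x => μ.map (Y (a k x)) := fun k =>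
    (iIndepFun_iff_map_fun_eq_infinitePi_map (fun _ => hY _)).1
      (h.precomp (g := a k) fun x y hxy => by
        have := @ha ⟨k, x⟩ ⟨k, y⟩ hxy
        simpa using this)
  simp_rw [h3]
  rw [h2, ← Measure.map_map (by fun_prop) (by fun_prop), h1]
  exact Measure.infinitePi_map_piCurry (fun (k : κ) (x : α k) => μ.map (Y (a k x)))

/-- Conditioning on `Y` in the independent case: Fubini for the product law, pulled back to `Ω`. -/
lemma _root_.ProbabilityTheory.IndepFun.lintegral_comp_prodMk {𝓨 𝓩 : Type*} [MeasurableSpace 𝓨]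
    [MeasurableSpace 𝓩] [IsProbabilityMeasure μ] {Y : Ω → 𝓨} {Z : Ω → 𝓩} (h : IndepFun Y Z μ)
    (hY : AEMeasurable Y μ) (hZ : AEMeasurable Z μ) {F : 𝓨 → 𝓩 → ℝ≥0∞}
    (hF : Measurable (Function.uncurry F)) :
    ∫⁻ ω, F (Y ω) (Z ω) ∂μ = ∫⁻ ω, ∫⁻ ω', F (Y ω) (Z ω') ∂μ ∂μ := by
  have h1 := (indepFun_iff_map_prod_eq_prod_map_map hY hZ).1 h
  have := Measure.isProbabilityMeasure_map hY
  have := Measure.isProbabilityMeasure_map hZ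
  calc ∫⁻ ω, F (Y ω) (Z ω) ∂μ
      = ∫⁻ p, Function.uncurry F p ∂(μ.map fun ω => (Y ω, Z ω)) := by
        rw [lintegral_map' hF.aemeasurable (hY.prodMk hZ)]; rfl
    _ = ∫⁻ y, ∫⁻ z, F y z ∂(μ.map Z) ∂(μ.map Y) := by
        rw [h1, lintegral_prod _ hF.aemeasurable]; rfl
    _ = ∫⁻ ω, ∫⁻ z, F (Y ω) z ∂(μ.map Z) ∂μ := by
        rw [lintegral_map' _ hY]
        exact (Measurable.lintegral_prod_right hF).aemeasurable
    _ = _ := by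
        refine lintegral_congr fun ω => ?_
        rw [lintegral_map' _ hZ]
        exact (hF.comp measurable_prodMk_left).aemeasurable

end Independence

/-! ### Sums over the Ulam–Harris tree -/

/-- Words list the latest birth first, so the last letter names the child of the root from which an
individual descends. -/
lemma tsum_list_eq (F : List ℕ → ℝ≥0∞) : ∑' w, F w = F [] + ∑' i, ∑' v, F (v ++ [i]) := by
  let e : Unit ⊕ (ℕ × List ℕ) → List ℕ := Sum.elim (fun _ => []) fun p => p.2 ++ [p.1]
  have he : Function.Bijective e := by
    constructor
    · rintro (⟨⟩ | ⟨i, v⟩) (⟨⟩ | ⟨j, w⟩) h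
      · rfl
      · simp [e] at h
      · simp [e] at h
      · have h' : v ++ [i] = w ++ [j] := h
        have := List.append_inj_right' h' rfl
        have := List.append_inj_left' h' rfl
        simp_all
    · intro w
      rcases List.eq_nil_or_concat w with rfl | ⟨v, i, rfl⟩
      · exact ⟨.inl (), rfl⟩
      · exact ⟨.inr (i, v), List.concat_eq_append.symm⟩
  rw [← (Equiv.ofBijective e he).tsum_eq, Summable.tsum_sum ENNReal.summable ENNReal.summable, ENNReal.tsum_prod']
  simp [e]

lemma measurable_birthTime (w : List ℕ) :
    Measurable fun ξ : List ℕ → ℕ → ℝ≥0∞ => birthTime ξ w := by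
  induction w with
  | nil => exact measurable_const
  | cons i w ih => exact ih.add (by fun_prop)

/-- The subtree of the child number `i` of the root. -/
def subtree (ξ : List ℕ → ℕ → ℝ≥0∞) (i : ℕ) : List ℕ → ℕ → ℝ≥0∞ := fun v => ξ (v ++ [i])

/-- The sum of `f` over the birth times of the individuals up to generation `n`, in a tree whose
root is born at time `s`. -/
def generationSum (f : ℝ≥0∞ → ℝ≥0∞) (n : ℕ) (ξ : List ℕ → ℕ → ℝ≥0∞) (s : ℝ≥0∞) : ℝ≥0∞ :=
  ∑' w : List ℕ, if w.length ≤ n then f (s + birthTime ξ w) else 0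

lemma generationSum_zero (f : ℝ≥0∞ → ℝ≥0∞) (ξ : List ℕ → ℕ → ℝ≥0∞) (s : ℝ≥0∞) :
    generationSum f 0 ξ s = f s := by
  simp [generationSum, birthTime]

/-- The branching property at the root. The birth time `s` is a parameter because each subtree is
again a tree, with its root born at a shifted time. -/
lemma generationSum_succ (f : ℝ≥0∞ → ℝ≥0∞) (n : ℕ) (ξ : List ℕ → ℕ → ℝ≥0∞) (s : ℝ≥0∞) :
    generationSum f (n + 1) ξ s =
      f s + ∑' i, generationSum f n (subtree ξ i) (s + ξ [] i) := by
  simp [generationSum, tsum_list_eq (fun w => ite (w.length ≤ n + 1) _ _), birthTime,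
    birthTime_append, add_assoc]
  rfl

lemma measurable_generationSum {f : ℝ≥0∞ → ℝ≥0∞} (hf : Measurable f) (n : ℕ) :
    Measurable (Function.uncurry (generationSum f n)) := by
  refine Measurable.tsum fun w => ?_
  split_ifs
  · exact hf.comp (measurable_snd.add ((measurable_birthTime w).comp measurable_fst))
  · exact measurable_const

lemma measurable_expNeg_generationSum {f : ℝ≥0∞ → ℝ≥0∞} (hf : Measurable f) (n : ℕ) {α : Type*}
    [MeasurableSpace α] {g : α → List ℕ → ℕ → ℝ≥0∞} {t : α → ℝ≥0∞} (hg : Measurable g)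
    (ht : Measurable t) : Measurable fun a => expNeg (generationSum f n (g a) (t a)) :=
  measurable_expNeg.comp ((measurable_generationSum hf n).comp (hg.prodMk ht))

lemma tendsto_generationSum (f : ℝ≥0∞ → ℝ≥0∞) (ξ : List ℕ → ℕ → ℝ≥0∞) (s : ℝ≥0∞) :
    Tendsto (fun n => generationSum f n ξ s) atTop (𝓝 (∑' w, f (s + birthTime ξ w))) := by
  let _ : MeasurableSpace (List ℕ) := ⊤
  have : MeasurableSingletonClass (List ℕ) := ⟨fun _ => trivial⟩
  simp_rw [generationSum, ← lintegral_count]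
  refine lintegral_tendsto_of_tendsto_of_monotone
    (fun n => Measurable.aemeasurable fun _ _ => trivial)
    (ae_of_all _ fun w m n hmn => ?_) (ae_of_all _ fun w => ?_)
  · by_cases h : w.length ≤ m
    · simp [h, h.trans hmn]
    · simp [h]
  · refine tendsto_const_nhds.congr' ?_
    filter_upwards [eventually_ge_atTop w.length] with n hn
    simp [hn]

/-! ### The Laplace functional of a branching process -/

/-- The Laplace functional of the first `n` generations of a branching process whose individuals
reproduce according to Poisson processes with intensity `Λ`, as a function of the birth time `s` of
the root. -/
def laplaceIter (Λ : Measure ℝ) (f : ℝ≥0∞ → ℝ≥0∞) : ℕ → ℝ≥0∞ → ℝ≥0∞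
  | 0, s => expNeg (f s)
  | n + 1, s => expNeg (f s) *
      expNeg (∫⁻ u, (1 - laplaceIter Λ f n (s + ENNReal.ofReal u)) ∂Λ)

/-- The Laplace functional of a branching process whose individuals reproduce according to Poisson
processes with intensity `Λ`, as a function of the birth time `s` of the root. -/
def laplaceLimit (Λ : Measure ℝ) (f : ℝ≥0∞ → ℝ≥0∞) (s : ℝ≥0∞) : ℝ≥0∞ :=
  ⨅ n, laplaceIter Λ f n s

section Laplace

variable {Λ : Measure ℝ} {f : ℝ≥0∞ → ℝ≥0∞}

lemma laplaceIter_le_one (n : ℕ) (s : ℝ≥0∞) : laplaceIter Λ f n s ≤ 1 := by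
  cases n with
  | zero => exact expNeg_le_one _
  | succ n => exact mul_le_one' (expNeg_le_one _) (expNeg_le_one _)

/-- Descendants are born after their ancestor, so nothing is counted once `f` has vanished for good.
At `s = ∞` this gives the factor `1` to children that are never born. -/
lemma laplaceIter_eq_one {s : ℝ≥0∞} (h : ∀ t, s ≤ t → f t = 0) (n : ℕ) :
    ∀ t, s ≤ t → laplaceIter Λ f n t = 1 := by
  induction n with
  | zero => intro t ht; simp [laplaceIter, h t ht]
  | succ n ih =>
    intro t ht
    simp [laplaceIter, h t ht, ih _ (ht.trans le_self_add)]

lemma antitone_laplaceIter (s : ℝ≥0∞) : Antitone fun n => laplaceIter Λ f n s := by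
  refine antitone_nat_of_succ_le fun n => ?_
  induction n generalizing s with
  | zero => exact mul_le_of_le_one_right' (expNeg_le_one _)
  | succ n ih =>
    exact mul_le_mul_right (expNeg_antitone (lintegral_mono fun u =>
      tsub_le_tsub_left (ih (s + ENNReal.ofReal u)) 1)) _

lemma measurable_laplaceIter [SFinite Λ] (hf : Measurable f) (n : ℕ) :
    Measurable (laplaceIter Λ f n) := by
  induction n with
  | zero => exact measurable_expNeg.comp hf
  | succ n ih =>
    refine (measurable_expNeg.comp hf).mul (measurable_expNeg.comp ?_)
    refine Measurable.lintegral_prod_right' (f := fun p : ℝ≥0∞ × ℝ =>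
      1 - laplaceIter Λ f n (p.1 + ENNReal.ofReal p.2)) ?_
    exact measurable_const.sub (ih.comp (by fun_prop))

lemma tendsto_laplaceIter (s : ℝ≥0∞) :
    Tendsto (fun n => laplaceIter Λ f n s) atTop (𝓝 (laplaceLimit Λ f s)) :=
  tendsto_atTop_iInf (antitone_laplaceIter s)

lemma measurable_laplaceLimit [SFinite Λ] (hf : Measurable f) : Measurable (laplaceLimit Λ f) :=
  Measurable.iInf fun n => measurable_laplaceIter hf n

lemma laplaceLimit_le_one (s : ℝ≥0∞) : laplaceLimit Λ f s ≤ 1 :=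
  iInf_le_of_le 0 (laplaceIter_le_one 0 s)

lemma laplaceLimit_eq_one {s : ℝ≥0∞} (h : ∀ t, s ≤ t → f t = 0) :
    laplaceLimit Λ f s = 1 := by
  simp [laplaceLimit, laplaceIter_eq_one h _ s le_rfl]

/-- The outer intensity `Λ₀` is kept separate from `Λ`: `Λ₀ = Λ` yields the fixed point equation,
and a different `Λ₀` yields the functional of a process with a special root. -/
lemma tendsto_laplaceIter_succ [SFinite Λ] (hf : Measurable f) (Λ₀ : Measure ℝ) (s : ℝ≥0∞) :
    Tendsto (fun n => expNeg (f s) *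
        expNeg (∫⁻ u, (1 - laplaceIter Λ f n (s + ENNReal.ofReal u)) ∂Λ₀)) atTop
      (𝓝 (expNeg (f s) *
        expNeg (∫⁻ u, (1 - laplaceLimit Λ f (s + ENNReal.ofReal u)) ∂Λ₀))) := by
  refine ENNReal.Tendsto.const_mul ((continuous_expNeg.tendsto _).comp ?_)
    (Or.inr (expNeg_ne_top _))
  refine lintegral_tendsto_of_tendsto_of_monotone (fun n => ?_)
    (ae_of_all _ fun u m n hmn => tsub_le_tsub_left (antitone_laplaceIter _ hmn) 1)
    (ae_of_all _ fun u => ENNReal.Tendsto.sub tendsto_const_nhds (tendsto_laplaceIter _)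
      (Or.inl ENNReal.one_ne_top))
  exact (measurable_const.sub ((measurable_laplaceIter hf n).comp (by fun_prop))).aemeasurable

/-- The limit of the recursion over generations. Uniqueness of the solution plays no role, since
both processes are expressed through this particular one. -/
lemma laplaceLimit_eq [SFinite Λ] (hf : Measurable f) (s : ℝ≥0∞) :
    laplaceLimit Λ f s = expNeg (f s) *
      expNeg (∫⁻ u, (1 - laplaceLimit Λ f (s + ENNReal.ofReal u)) ∂Λ) :=
  tendsto_nhds_unique ((tendsto_laplaceIter s).comp (tendsto_add_atTop_nat 1))
    (tendsto_laplaceIter_succ hf Λ s)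

end Laplace

section PoissonBranching

variable {Ω : Type*} [MeasurableSpace Ω] {μ : Measure Ω}

/-- All individuals reproduce independently, the root according to a Poisson process with intensity
`Λ₀`, and every other individual according to a Poisson process with intensity `Λ`. -/
structure IsPoissonBranching (Λ₀ Λ : Measure ℝ) (ξ : Ω → List ℕ → ℕ → ℝ≥0∞)
    (μ : Measure Ω) : Prop where
  root : IsPoissonPointProcess (fun ω => ξ ω []) Λ₀ μ
  nonroot : ∀ w, w ≠ [] → IsPoissonPointProcess (fun ω => ξ ω w) Λ μ
  indep : iIndepFun (fun w ω => ξ ω w) μ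

namespace IsPoissonBranching

variable {Λ₀ Λ : Measure ℝ} {ξ : Ω → List ℕ → ℕ → ℝ≥0∞}

lemma measurable_apply (h : IsPoissonBranching Λ₀ Λ ξ μ) (w : List ℕ) :
    Measurable fun ω => ξ ω w := by
  by_cases hw : w = []
  · exact hw ▸ h.root.measurable
  · exact (h.nonroot w hw).measurable

lemma measurable (h : IsPoissonBranching Λ₀ Λ ξ μ) : Measurable ξ :=
  measurable_pi_iff.2 h.measurable_apply

/-- Below the root the special intensity `Λ₀` disappears, so an induction over generations closes
within the class `Λ₀ = Λ`. -/
lemma subtree (h : IsPoissonBranching Λ₀ Λ ξ μ) (i : ℕ) :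
    IsPoissonBranching Λ Λ (fun ω => subtree (ξ ω) i) μ where
  root := h.nonroot _ (by simp)
  nonroot w _ := h.nonroot _ (by simp)
  indep := h.indep.precomp (g := fun w => w ++ [i]) (List.append_left_injective _)

lemma measurable_subtree (h : IsPoissonBranching Λ₀ Λ ξ μ) :
    Measurable fun ω => SelfReinforcement.subtree (ξ ω) :=
  measurable_pi_iff.2 fun i => (h.subtree i).measurable

lemma iIndepFun_subtree (h : IsPoissonBranching Λ₀ Λ ξ μ) :
    iIndepFun (fun i ω => SelfReinforcement.subtree (ξ ω) i) μ :=
  h.indep.curry h.measurable_apply (fun (i : ℕ) v => v ++ [i]) fun p q hpq => by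
    obtain ⟨i, v⟩ := p
    obtain ⟨j, w⟩ := q
    have := List.append_inj_right' hpq rfl
    have := List.append_inj_left' hpq rfl
    simp_all

lemma indepFun_root_subtree (h : IsPoissonBranching Λ₀ Λ ξ μ) :
    IndepFun (fun ω => ξ ω []) (fun ω => SelfReinforcement.subtree (ξ ω)) μ := by
  have := h.indep.indepFun_of_disjoint h.measurable_apply (fun _ : Unit => [])
    (fun p : ℕ × List ℕ => p.2 ++ [p.1]) (by simp)
  exact this.comp (φ := fun x => x ()) (ψ := fun x i v => x (i, v))
    (@measurable_pi_apply Unit (fun _ => ℕ → ℝ≥0∞) _ ()) (by fun_prop)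

/-- Given the reproduction times of the root, the subtrees are independent, so each contribution may
be replaced by its mean `q` at the birth time of the child. This is done for the first `m` children,
and then `m` tends to infinity. -/
lemma lintegral_expNeg_tsum_generationSum (h : IsPoissonBranching Λ₀ Λ ξ μ)
    {f q : ℝ≥0∞ → ℝ≥0∞} (hf : Measurable f) {n : ℕ} (hq1 : ∀ t, q t ≤ 1)
    (hq : ∀ i t, ∫⁻ ω, expNeg (generationSum f n (SelfReinforcement.subtree (ξ ω) i) t) ∂μ = q t)
    (s : ℝ≥0∞) :
    ∫⁻ ω, expNeg (∑' i, generationSum f n (SelfReinforcement.subtree (ξ ω) i) (s + ξ ω [] i)) ∂μ =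
      ∫⁻ ω, expNeg (∑' i, negLog (q (s + ξ ω [] i))) ∂μ := by
  have := h.indep.isProbabilityMeasure
  have hfin : ∀ m, ∫⁻ ω, ∏ i ∈ Finset.range m, expNeg (generationSum f n
        (SelfReinforcement.subtree (ξ ω) i) (s + ξ ω [] i)) ∂μ =
      ∫⁻ ω, ∏ i ∈ Finset.range m, expNeg (negLog (q (s + ξ ω [] i))) ∂μ := by
    intro m
    rw [h.indepFun_root_subtree.lintegral_comp_prodMk h.root.measurable.aemeasurable
      h.measurable_subtree.aemeasurable (F := fun t x => ∏ i ∈ Finset.range m,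
        expNeg (generationSum f n (x i) (s + t i)))]
    · refine lintegral_congr fun ω => ?_
      have hm' : ∀ i, Measurable fun x : List ℕ → ℕ → ℝ≥0∞ =>
          expNeg (generationSum f n x (s + ξ ω [] i)) := fun i =>
        measurable_expNeg_generationSum hf n measurable_id measurable_const
      refine (lintegral_prod_eq_prod_lintegral_of_indepFun _ _ (h.iIndepFun_subtree.comp _ hm')
        fun i => (hm' i).comp (h.subtree i).measurable).trans ?_
      refine Finset.prod_congr rfl fun i _ => ?_
      rw [expNeg_negLog (hq1 _)]
      exact hq i _
    · exact Finset.measurable_prod _ fun i _ =>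
        measurable_expNeg_generationSum hf n (by fun_prop) (by fun_prop)
  have hL : Tendsto (fun m => ∫⁻ ω, ∏ i ∈ Finset.range m, expNeg (generationSum f n
        (SelfReinforcement.subtree (ξ ω) i) (s + ξ ω [] i)) ∂μ) atTop
      (𝓝 (∫⁻ ω, expNeg (∑' i, generationSum f n
        (SelfReinforcement.subtree (ξ ω) i) (s + ξ ω [] i)) ∂μ)) := by
    refine tendsto_lintegral_of_dominated_convergence (fun _ => 1) (fun m => ?_)
      (fun m => ae_of_all _ fun ω => Finset.prod_le_one' fun i _ => expNeg_le_one _) (by simp)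
      (ae_of_all _ fun ω => tendsto_expNeg_sum_range _)
    exact Finset.measurable_prod _ fun i _ => measurable_expNeg_generationSum hf n
      (h.subtree i).measurable
      (measurable_const.add ((measurable_pi_apply i).comp h.root.measurable))
  have hR : Tendsto (fun m => ∫⁻ ω, ∏ i ∈ Finset.range m,
        expNeg (negLog (q (s + ξ ω [] i))) ∂μ) atTop
      (𝓝 (∫⁻ ω, expNeg (∑' i, negLog (q (s + ξ ω [] i))) ∂μ)) := by
    -- Measurability of `q` is inherited from its representation as an integral with parameter.
    have hqm : Measurable q := by
      have : q = fun t => ∫⁻ ω, expNeg (generationSum f n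
          (SelfReinforcement.subtree (ξ ω) 0) t) ∂μ := funext fun t => (hq 0 t).symm
      rw [this]
      refine Measurable.lintegral_prod_right' (f := fun p : ℝ≥0∞ × Ω =>
        expNeg (generationSum f n (SelfReinforcement.subtree (ξ p.2) 0) p.1)) ?_
      exact measurable_expNeg_generationSum hf n
        ((h.subtree 0).measurable.comp measurable_snd) measurable_fst
    refine tendsto_lintegral_of_dominated_convergence (fun _ => 1) (fun m => ?_)
      (fun m => ae_of_all _ fun ω => Finset.prod_le_one' fun i _ => expNeg_le_one _) (by simp)
      (ae_of_all _ fun ω => tendsto_expNeg_sum_range _)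
    exact Finset.measurable_prod _ fun i _ => measurable_expNeg.comp (measurable_negLog.comp
      (hqm.comp (measurable_const.add ((measurable_pi_apply i).comp h.root.measurable))))
  simp_rw [hfin] at hL
  exact tendsto_nhds_unique hL hR

/-- The means of the subtrees form a product over the points of the root's Poisson process, to which
the Laplace functional applies with `φ = -log` of that mean. The requirement `φ ∞ = 0` comes from `f
∞ = 0`. -/
lemma lintegral_expNeg_generationSum_succ [SigmaFinite Λ₀] [SFinite Λ]
    (h : IsPoissonBranching Λ₀ Λ ξ μ) {f : ℝ≥0∞ → ℝ≥0∞} (hf : Measurable f) (hf0 : f ∞ = 0)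
    {n : ℕ} (hq : ∀ i t,
      ∫⁻ ω, expNeg (generationSum f n (SelfReinforcement.subtree (ξ ω) i) t) ∂μ =
        laplaceIter Λ f n t) (s : ℝ≥0∞) :
    ∫⁻ ω, expNeg (generationSum f (n + 1) (ξ ω) s) ∂μ =
      expNeg (f s) * expNeg (∫⁻ u, (1 - laplaceIter Λ f n (s + ENNReal.ofReal u)) ∂Λ₀) := by
  have := h.indep.isProbabilityMeasure
  have hq1 := laplaceIter_le_one (Λ := Λ) (f := f) n
  simp_rw [generationSum_succ, expNeg_add]
  rw [lintegral_const_mul' _ _ (expNeg_ne_top _), h.lintegral_expNeg_tsum_generationSum hf hq1 hq,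
    h.root.lintegral_expNeg_tsum (φ := fun x => negLog (laplaceIter Λ f n (s + x)))]
  · simp_rw [expNeg_negLog (hq1 _)]
  · exact measurable_negLog.comp
      ((measurable_laplaceIter hf n).comp (measurable_const.add measurable_id))
  · rw [add_top, laplaceIter_eq_one (s := ∞) _ n _ le_rfl, negLog_one]
    intro t ht
    rw [top_le_iff.1 ht, hf0]

lemma lintegral_expNeg_generationSum [SigmaFinite Λ] {f : ℝ≥0∞ → ℝ≥0∞} (hf : Measurable f)
    (hf0 : f ∞ = 0) (n : ℕ) (h : IsPoissonBranching Λ Λ ξ μ) (s : ℝ≥0∞) :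
    ∫⁻ ω, expNeg (generationSum f n (ξ ω) s) ∂μ = laplaceIter Λ f n s := by
  have := h.indep.isProbabilityMeasure
  induction n generalizing ξ s with
  | zero => simp [generationSum_zero, laplaceIter]
  | succ n ih =>
    exact h.lintegral_expNeg_generationSum_succ hf hf0 (fun i t => ih (h.subtree i) t) s

/-- The Laplace functional of the birth times in a Poisson branching process. -/
theorem lintegral_expNeg_tsum_birthTime [SigmaFinite Λ₀] [SigmaFinite Λ]
    (h : IsPoissonBranching Λ₀ Λ ξ μ) {f : ℝ≥0∞ → ℝ≥0∞} (hf : Measurable f) (hf0 : f ∞ = 0) :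
    ∫⁻ ω, expNeg (∑' w, f (birthTime (ξ ω) w)) ∂μ =
      expNeg (f 0) * expNeg (∫⁻ u, (1 - laplaceLimit Λ f (ENNReal.ofReal u)) ∂Λ₀) := by
  have := h.indep.isProbabilityMeasure
  -- The root reproduces with `Λ₀` and all later generations with `Λ`, so the `n + 1` generations
  -- split as one outer step and the iterate `n`.
  have h1 := tendsto_laplaceIter_succ (Λ := Λ) hf Λ₀ 0
  have h2 : Tendsto (fun n => ∫⁻ ω, expNeg (generationSum f (n + 1) (ξ ω) 0) ∂μ) atTop
      (𝓝 (∫⁻ ω, expNeg (∑' w, f (0 + birthTime (ξ ω) w)) ∂μ)) := by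
    refine tendsto_lintegral_of_dominated_convergence (fun _ => 1) (fun m => ?_)
      (fun m => ae_of_all _ fun ω => expNeg_le_one _) (by simp)
      (ae_of_all _ fun ω => (continuous_expNeg.tendsto _).comp
        ((tendsto_generationSum f (ξ ω) 0).comp (tendsto_add_atTop_nat 1)))
    exact measurable_expNeg_generationSum hf _ h.measurable measurable_const
  simp_rw [fun n => h.lintegral_expNeg_generationSum_succ hf hf0
    (fun i t => (h.subtree i).lintegral_expNeg_generationSum hf hf0 n t) 0] at h2
  simpa using tendsto_nhds_unique h2 h1

end IsPoissonBranching

end PoissonBranching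

/-! ### Laws with a given hazard rate -/

/-- As `a` is only measurable and locally bounded, the classical fundamental theorem does not apply.
Instead `exp(-∫ a)` is Lipschitz, hence absolutely continuous, and its derivative is computed almost
everywhere. -/
lemma integral_mul_exp_neg_integral {a : ℝ → ℝ} (ha : Measurable a) (h0 : ∀ x, 0 < x → 0 ≤ a x)
    {N K s : ℝ} (hK : ∀ x, 0 < x → x ≤ N → a x ≤ K) (hs : 0 ≤ s) (hsN : s ≤ N) :
    ∫ x in s..N, a x * Real.exp (-∫ u in (0 : ℝ)..x, a u) =
      Real.exp (-∫ u in (0 : ℝ)..s, a u) - Real.exp (-∫ u in (0 : ℝ)..N, a u) := by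
  have hN : 0 ≤ N := hs.trans hsN
  have hK0 : 0 ≤ max K 0 := le_max_right _ _
  have hab : ∀ x, x ∈ Set.Ioc 0 N → ‖a x‖ ≤ max K 0 := fun x hx => by
    rw [Real.norm_of_nonneg (h0 x hx.1)]
    exact (hK x hx.1 hx.2).trans (le_max_left _ _)
  have hint : ∀ x y, x ∈ Set.Icc 0 N → y ∈ Set.Icc 0 N → IntervalIntegrable a volume x y := by
    intro x y hx hy
    rw [intervalIntegrable_iff]
    refine Measure.integrableOn_of_bounded (M := max K 0) (by simp) ha.aestronglyMeasurable ?_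
    refine (ae_restrict_iff' measurableSet_uIoc).2 (ae_of_all _ fun z hz => hab z ?_)
    rw [Set.mem_uIoc] at hz
    rcases hz with hz | hz
    · exact ⟨hx.1.trans_lt hz.1, hz.2.trans hy.2⟩
    · exact ⟨hy.1.trans_lt hz.1, hz.2.trans hx.2⟩
  have h0N : (0 : ℝ) ∈ Set.Icc 0 N := ⟨le_rfl, hN⟩
  have hA0 : ∀ x ∈ Set.Icc 0 N, 0 ≤ ∫ u in (0 : ℝ)..x, a u := fun x hx =>
    intervalIntegral.integral_nonneg_of_ae_restrict hx.1 (by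
      rw [← Measure.restrict_congr_set Ioc_ae_eq_Icc]
      exact (ae_restrict_iff' measurableSet_Ioc).2 (ae_of_all _ fun z hz => h0 z hz.1))
  set B : ℝ → ℝ := fun x => Real.exp (-∫ u in (0 : ℝ)..x, a u) with hB
  have hsub : Set.uIcc s N ⊆ Set.Icc 0 N := by
    rw [Set.uIcc_of_le hsN]
    exact Set.Icc_subset_Icc_left hs
  have hlip : LipschitzOnWith (max K 0).toNNReal B (Set.uIcc s N) := by
    refine LipschitzOnWith.of_dist_le_mul fun x hx y hy => ?_
    have hx := hsub hx
    have hy := hsub hy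
    rw [Real.coe_toNNReal _ hK0, Real.dist_eq, Real.dist_eq]
    have h1 : |(∫ u in (0 : ℝ)..x, a u) - ∫ u in (0 : ℝ)..y, a u| ≤ max K 0 * |x - y| := by
      rw [intervalIntegral.integral_interval_sub_left (hint _ _ h0N hx) (hint _ _ h0N hy)]
      refine intervalIntegral.norm_integral_le_of_norm_le_const fun z hz => hab z ?_
      rw [Set.mem_uIoc] at hz
      rcases hz with hz | hz
      · exact ⟨hy.1.trans_lt hz.1, hz.2.trans hx.2⟩
      · exact ⟨hx.1.trans_lt hz.1, hz.2.trans hy.2⟩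
    refine le_trans ?_ h1
    -- The map `p ↦ exp(-p)` is `1`-Lipschitz on `[0, ∞)`.
    have key : ∀ p q : ℝ, 0 ≤ p → p ≤ q → |Real.exp (-p) - Real.exp (-q)| ≤ |p - q| := by
      intro p q hp hpq
      have e1 : Real.exp (-q) ≤ Real.exp (-p) := Real.exp_le_exp.2 (by linarith)
      rw [abs_of_nonneg (by linarith), abs_of_nonpos (by linarith)]
      have e2 : Real.exp (-q) = Real.exp (-p) * Real.exp (p - q) := by
        rw [← Real.exp_add]; ring_nf
      have e3 := Real.add_one_le_exp (p - q)
      have e4 : Real.exp (-p) ≤ 1 := Real.exp_le_one_iff.2 (by linarith)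
      have e5 := Real.exp_pos (-p)
      nlinarith
    rcases le_total (∫ u in (0 : ℝ)..x, a u) (∫ u in (0 : ℝ)..y, a u) with h | h
    · exact key _ _ (hA0 x hx) h
    · have := key _ _ (hA0 y hy) h
      rwa [abs_sub_comm, abs_sub_comm (∫ u in (0 : ℝ)..y, a u)] at this
  have hftc := hlip.absolutelyContinuousOnInterval.integral_deriv_eq_sub
  have hder : ∫ x in s..N, deriv B x = ∫ x in s..N, -(a x * B x) := by
    refine intervalIntegral.integral_congr_ae ?_
    filter_upwards [(hint 0 N h0N ⟨hN, le_rfl⟩).ae_hasDerivAt_integral] with x hx hxs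
    have hx' := hx (Set.uIcc_of_le hN ▸ hsub (Set.uIoc_subset_uIcc hxs)) 0 (by simp)
    have hx'' : HasDerivAt B (B x * -a x) x := hx'.neg.exp
    rw [hx''.deriv]
    ring
  rw [hder, intervalIntegral.integral_neg] at hftc
  linarith

/-- The integral up to a finite bound telescopes, and infinite total hazard makes the boundary term
at infinity vanish. -/
lemma lintegral_Ioi_mul_expNeg {a : ℝ → ℝ} (ha : Measurable a) (h0 : ∀ x, 0 < x → 0 ≤ a x)
    (hb : ∀ N, ∃ K, ∀ x, 0 < x → x ≤ N → a x ≤ K)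
    (hinf : ∫⁻ x in Set.Ioi 0, ENNReal.ofReal (a x) = ∞) {s : ℝ} (hs : 0 ≤ s) :
    ∫⁻ x in Set.Ioi s, ENNReal.ofReal (a x) *
        expNeg (∫⁻ u in Set.Ioc 0 x, ENNReal.ofReal (a u)) =
      expNeg (∫⁻ u in Set.Ioc 0 s, ENNReal.ofReal (a u)) := by
  have hmeas : Measurable fun x => ENNReal.ofReal (a x) := ENNReal.measurable_ofReal.comp ha
  have hint : ∀ N, IntegrableOn a (Set.Ioc 0 N) := by
    intro N
    obtain ⟨K, hK⟩ := hb N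
    refine Measure.integrableOn_of_bounded (M := K) (by simp) ha.aestronglyMeasurable ?_
    refine (ae_restrict_iff' measurableSet_Ioc).2 (ae_of_all _ fun z hz => ?_)
    rw [Real.norm_of_nonneg (h0 z hz.1)]
    exact hK z hz.1 hz.2
  have hnn : ∀ N, 0 ≤ᵐ[volume.restrict (Set.Ioc 0 N)] a := fun N =>
    (ae_restrict_iff' measurableSet_Ioc).2 (ae_of_all _ fun z hz => h0 z hz.1)
  have hA : ∀ x, 0 ≤ x → ∫⁻ u in Set.Ioc 0 x, ENNReal.ofReal (a u) =
      ENNReal.ofReal (∫ u in (0 : ℝ)..x, a u) := fun x hx => by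
    rw [intervalIntegral.integral_of_le hx, ofReal_integral_eq_lintegral_ofReal (hint x) (hnn x)]
  have hA0 : ∀ x, 0 ≤ x → 0 ≤ ∫ u in (0 : ℝ)..x, a u := fun x hx => by
    rw [intervalIntegral.integral_of_le hx]
    exact integral_nonneg_of_ae (hnn x)
  have hE : ∀ x, 0 ≤ x → expNeg (∫⁻ u in Set.Ioc 0 x, ENNReal.ofReal (a u)) =
      ENNReal.ofReal (Real.exp (-∫ u in (0 : ℝ)..x, a u)) := fun x hx => by
    rw [hA x hx, expNeg_ofReal (hA0 x hx)]
  have hanti : Antitone fun x : ℝ => expNeg (∫⁻ u in Set.Ioc 0 x, ENNReal.ofReal (a u)) :=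
    fun x y hxy => expNeg_antitone (lintegral_mono_set (Set.Ioc_subset_Ioc_right hxy))
  have hcover : AECover (volume.restrict (Set.Ioi s)) atTop fun n : ℕ => Set.Iic (s + n) :=
    aecover_Iic (tendsto_atTop_add_const_left _ _ tendsto_natCast_atTop_atTop)
  refine hcover.lintegral_eq_of_tendsto _ (hmeas.mul hanti.measurable).aemeasurable ?_
  have hval : ∀ n : ℕ, ∫⁻ x in Set.Iic (s + n), ENNReal.ofReal (a x) *
        expNeg (∫⁻ u in Set.Ioc 0 x, ENNReal.ofReal (a u)) ∂(volume.restrict (Set.Ioi s)) =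
      expNeg (∫⁻ u in Set.Ioc 0 s, ENNReal.ofReal (a u)) -
        expNeg (∫⁻ u in Set.Ioc 0 (s + n), ENNReal.ofReal (a u)) := by
    intro n
    have hsn : s ≤ s + n := by simp
    obtain ⟨K, hK⟩ := hb (s + n)
    rw [Measure.restrict_restrict measurableSet_Iic, Set.inter_comm, Set.Ioi_inter_Iic,
      hE s hs, hE _ (hs.trans hsn), ← ENNReal.ofReal_sub _ (Real.exp_pos _).le,
      ← integral_mul_exp_neg_integral ha h0 hK hs hsn, intervalIntegral.integral_of_le hsn,
      ofReal_integral_eq_lintegral_ofReal]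
    · refine setLIntegral_congr_fun measurableSet_Ioc fun x hx => ?_
      rw [hE x (hs.trans hx.1.le), ← ENNReal.ofReal_mul (h0 x (hs.trans_lt hx.1))]
    · refine Integrable.mul_bdd (c := 1) ((hint (s + n)).mono_set
        (Set.Ioc_subset_Ioc_left hs)) ?_ ?_
      · have hm : AntitoneOn (fun x => Real.exp (-∫ u in (0 : ℝ)..x, a u)) (Set.Ioc s (s + n)) := by
          intro x hx y hy hxy
          have hx0 := hs.trans hx.1.le
          have hy0 := hs.trans hy.1.le
          have := hanti hxy
          simp only [hE x hx0, hE y hy0] at this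
          exact (ENNReal.ofReal_le_ofReal_iff (Real.exp_pos _).le).1 this
        exact (aemeasurable_restrict_of_antitoneOn measurableSet_Ioc hm).aestronglyMeasurable
      · refine (ae_restrict_iff' measurableSet_Ioc).2 (ae_of_all _ fun x hx => ?_)
        rw [Real.norm_of_nonneg (Real.exp_pos _).le, Real.exp_le_one_iff]
        linarith [hA0 x (hs.trans hx.1.le)]
    · refine (ae_restrict_iff' measurableSet_Ioc).2 (ae_of_all _ fun x hx => ?_)
      exact mul_nonneg (h0 x (hs.trans_lt hx.1)) (Real.exp_pos _).le
  simp_rw [hval]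
  have hlim : Tendsto (fun n : ℕ => expNeg (∫⁻ u in Set.Ioc 0 (s + n), ENNReal.ofReal (a u)))
      atTop (𝓝 0) := by
    rw [← expNeg_top, ← hinf]
    refine (continuous_expNeg.tendsto _).comp ?_
    have hc : AECover (volume.restrict (Set.Ioi (0 : ℝ))) atTop fun n : ℕ => Set.Iic (s + n) :=
      aecover_Iic (tendsto_atTop_add_const_left _ _ tendsto_natCast_atTop_atTop)
    refine (hc.lintegral_tendsto_of_nat hmeas.aemeasurable).congr fun n => ?_
    rw [Measure.restrict_restrict measurableSet_Iic, Set.inter_comm, Set.Ioi_inter_Iic]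
  simpa using ENNReal.Tendsto.sub (tendsto_const_nhds
    (x := expNeg (∫⁻ u in Set.Ioc 0 s, ENNReal.ofReal (a u)))) hlim (Or.inl (expNeg_ne_top _))

/-- A hazard rate on `[0, ∞)` which is bounded away from `0` far from the origin. -/
structure IsHazardRate (h : ℝ → ℝ) : Prop where
  continuous : Continuous h
  nonneg : ∀ x, 0 ≤ x → 0 ≤ h x
  lower : ∃ ε, 0 < ε ∧ ∀ x, 1 ≤ x → ε ≤ h x

namespace IsHazardRate

variable {h : ℝ → ℝ}

lemma bounded (hh : IsHazardRate h) (N : ℝ) : ∃ K, ∀ x, 0 < x → x ≤ N → h x ≤ K := by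
  obtain ⟨K, hK⟩ := (isCompact_Icc (a := (0 : ℝ)) (b := N)).bddAbove_image hh.continuous.continuousOn
  exact ⟨K, fun x hx hxN => hK ⟨x, ⟨hx.le, hxN⟩, rfl⟩⟩

lemma lintegral_Ioi_eq_top (hh : IsHazardRate h) (T : ℝ) :
    ∫⁻ x in Set.Ioi T, ENNReal.ofReal (h x) = ∞ := by
  obtain ⟨ε, hε, hl⟩ := hh.lower
  refine top_le_iff.1 ?_
  calc ∞ = ∫⁻ _ in Set.Ioi (max T 1), ENNReal.ofReal ε := by simp [hε]
    _ ≤ ∫⁻ x in Set.Ioi (max T 1), ENNReal.ofReal (h x) :=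
        setLIntegral_mono' measurableSet_Ioi fun x hx =>
          ENNReal.ofReal_le_ofReal (hl x ((le_max_right _ _).trans (le_of_lt hx)))
    _ ≤ _ := lintegral_mono_set (Set.Ioi_subset_Ioi (le_max_left _ _))

/-- The density of the law with hazard rate `h`. -/
def density (h : ℝ → ℝ) (x : ℝ) : ℝ≥0∞ :=
  ENNReal.ofReal (h x) * expNeg (∫⁻ u in Set.Ioc 0 x, ENNReal.ofReal (h u))

lemma measurable_density (hh : IsHazardRate h) : Measurable (density h) :=
  (ENNReal.measurable_ofReal.comp hh.continuous.measurable).mul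
    (Antitone.measurable fun _ _ hxy =>
      expNeg_antitone (lintegral_mono_set (Set.Ioc_subset_Ioc_right hxy)))

lemma lintegral_density (hh : IsHazardRate h) {s : ℝ} (hs : 0 ≤ s) :
    ∫⁻ x in Set.Ioi s, density h x = expNeg (∫⁻ u in Set.Ioc 0 s, ENNReal.ofReal (h u)) :=
  lintegral_Ioi_mul_expNeg hh.continuous.measurable (fun x hx => hh.nonneg x hx.le) hh.bounded
    (hh.lintegral_Ioi_eq_top 0) hs

/-- The law with hazard rate `h`, as a measure on `[0, ∞]`. -/
def law (h : ℝ → ℝ) : Measure ℝ≥0∞ :=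
  ((volume.restrict (Set.Ioi 0)).withDensity (density h)).map ENNReal.ofReal

lemma lintegral_law (hh : IsHazardRate h) {F : ℝ≥0∞ → ℝ≥0∞} (hF : Measurable F) :
    ∫⁻ x, F x ∂(law h) = ∫⁻ x in Set.Ioi 0, density h x * F (ENNReal.ofReal x) := by
  rw [law, lintegral_map hF ENNReal.measurable_ofReal]
  exact lintegral_withDensity_eq_lintegral_mul _ hh.measurable_density
    (hF.comp ENNReal.measurable_ofReal)

lemma law_Ioi (hh : IsHazardRate h) (s : ℝ≥0) :
    law h (Set.Ioi s) = expNeg (∫⁻ u in Set.Ioc 0 (s : ℝ), ENNReal.ofReal (h u)) := by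
  rw [law, Measure.map_apply ENNReal.measurable_ofReal measurableSet_Ioi,
    withDensity_apply _ (ENNReal.measurable_ofReal measurableSet_Ioi),
    Measure.restrict_restrict (ENNReal.measurable_ofReal measurableSet_Ioi),
    ← hh.lintegral_density s.coe_nonneg]
  congr 2
  ext x
  simp only [Set.mem_inter_iff, Set.mem_preimage, Set.mem_Ioi]
  rw [← ENNReal.ofReal_coe_nnreal, ENNReal.ofReal_lt_ofReal_iff_of_nonneg s.coe_nonneg]
  exact ⟨fun hx => hx.1, fun hx => ⟨hx, s.coe_nonneg.trans_lt hx⟩⟩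

lemma isProbabilityMeasure_law (hh : IsHazardRate h) : IsProbabilityMeasure (law h) := by
  refine ⟨?_⟩
  have := hh.lintegral_law (F := 1) measurable_one
  simp only [Pi.one_apply, lintegral_one, mul_one] at this
  rw [this, hh.lintegral_density le_rfl]
  simp

/-- Only the tails at rational points are required, so almost sure identities for each single `s`
can be combined into one. -/
lemma eq_law (hh : IsHazardRate h) {ρ : Measure ℝ≥0∞} [IsProbabilityMeasure ρ]
    (hρ : ∀ r : ℚ, ρ (Set.Ioi ((r : ℝ).toNNReal : ℝ≥0∞)) =
      expNeg (∫⁻ u in Set.Ioc 0 ((r : ℝ).toNNReal : ℝ), ENNReal.ofReal (h u))) :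
    ρ = law h := by
  have := hh.isProbabilityMeasure_law
  refine Measure.ext_of_Iic _ _ fun a => ?_
  have hIoi : ρ (Set.Ioi a) = law h (Set.Ioi a) := by
    have hU : Set.Ioi a = ⋃ r : {r : ℚ // a < ((r : ℝ).toNNReal : ℝ≥0∞)},
        Set.Ioi ((r : ℝ).toNNReal : ℝ≥0∞) := by
      ext x
      simp only [Set.mem_Ioi, Set.mem_iUnion, Subtype.exists, exists_prop]
      rw [ENNReal.lt_iff_exists_rat_btwn]
      exact ⟨fun ⟨r, _, h1, h2⟩ => ⟨r, h1, h2⟩,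
        fun ⟨r, h1, h2⟩ => ENNReal.lt_iff_exists_rat_btwn.1 (h1.trans h2)⟩
    have hdir : Directed (· ⊆ ·) fun r : {r : ℚ // a < ((r : ℝ).toNNReal : ℝ≥0∞)} =>
        Set.Ioi ((r : ℝ).toNNReal : ℝ≥0∞) := by
      intro r r'
      rcases le_total r.1 r'.1 with hrr | hrr
      · refine ⟨r, subset_rfl, Set.Ioi_subset_Ioi ?_⟩
        exact ENNReal.coe_le_coe.2 (Real.toNNReal_mono (by exact_mod_cast hrr))
      · refine ⟨r', Set.Ioi_subset_Ioi ?_, subset_rfl⟩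
        exact ENNReal.coe_le_coe.2 (Real.toNNReal_mono (by exact_mod_cast hrr))
    rw [hU, hdir.measure_iUnion, hdir.measure_iUnion]
    simp_rw [hρ, hh.law_Ioi]
  rw [← Set.compl_Ioi, prob_compl_eq_one_sub measurableSet_Ioi,
    prob_compl_eq_one_sub measurableSet_Ioi, hIoi]

/-- If each point of a Poisson process with intensity `h` is kept with probability `1 - v`, then no
point is kept if and only if the first point, which has hazard rate `h`, is not kept, and neither is
any later point. -/
lemma lintegral_law_thinning (hh : IsHazardRate h) {v : ℝ≥0∞ → ℝ≥0∞} (hv : Measurable v)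
    (hv1 : ∀ x, v x ≤ 1) {T : ℝ≥0} (hT : ∀ x, (T : ℝ≥0∞) < x → v x = 1) :
    ∫⁻ x in Set.Ioi 0, density h x * (v (ENNReal.ofReal x) *
        expNeg (∫⁻ u in Set.Ioi x, ENNReal.ofReal (h u) * (1 - v (ENNReal.ofReal u)))) =
      expNeg (∫⁻ u in Set.Ioi 0, ENNReal.ofReal (h u) * (1 - v (ENNReal.ofReal u))) := by
  set a : ℝ → ℝ := fun x => h x * (v (ENNReal.ofReal x)).toReal with ha
  have hvm : Measurable fun x : ℝ => v (ENNReal.ofReal x) := hv.comp ENNReal.measurable_ofReal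
  have hhm : Measurable fun x : ℝ => ENNReal.ofReal (h x) :=
    ENNReal.measurable_ofReal.comp hh.continuous.measurable
  have ham : Measurable a := hh.continuous.measurable.mul hvm.ennreal_toReal
  have ha0 : ∀ x, 0 < x → 0 ≤ a x := fun x hx =>
    mul_nonneg (hh.nonneg x hx.le) ENNReal.toReal_nonneg
  have hae : ∀ x, 0 < x → ENNReal.ofReal (a x) = ENNReal.ofReal (h x) * v (ENNReal.ofReal x) :=
    fun x hx => by
      rw [ha, ENNReal.ofReal_mul (hh.nonneg x hx.le),
        ENNReal.ofReal_toReal (ne_top_of_le_ne_top ENNReal.one_ne_top (hv1 _))]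
  have hab : ∀ N, ∃ K, ∀ x, 0 < x → x ≤ N → a x ≤ K := fun N => by
    obtain ⟨K, hK⟩ := hh.bounded N
    refine ⟨K, fun x hx hxN => le_trans (mul_le_of_le_one_right (hh.nonneg x hx.le) ?_)
      (hK x hx hxN)⟩
    exact ENNReal.toReal_le_of_le_ofReal zero_le_one (by simpa using hv1 _)
  -- Beyond `T` one has `v = 1`, so there `a` equals `h`, whose total hazard is infinite.
  have hainf : ∫⁻ x in Set.Ioi 0, ENNReal.ofReal (a x) = ∞ := by
    refine top_le_iff.1 ?_
    rw [← hh.lintegral_Ioi_eq_top T]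
    refine le_trans (setLIntegral_mono' measurableSet_Ioi fun x hx => ?_)
      (lintegral_mono_set (Set.Ioi_subset_Ioi T.coe_nonneg))
    rw [hae x (T.coe_nonneg.trans_lt hx), hT _ _, mul_one]
    rw [← ENNReal.ofReal_coe_nnreal]
    exact (ENNReal.ofReal_lt_ofReal_iff_of_nonneg T.coe_nonneg).2 hx
  set D : ℝ → ℝ≥0∞ :=
    fun x => ∫⁻ u in Set.Ioi x, ENNReal.ofReal (h u) * (1 - v (ENNReal.ofReal u)) with hD
  have hgm : Measurable fun u => ENNReal.ofReal (h u) * (1 - v (ENNReal.ofReal u)) :=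
    hhm.mul (measurable_const.sub hvm)
  -- Split `h` into the kept rate `h (1 - v)` and the removed rate `a = h v`. The identity turns the
  -- integrand into `expNeg (D 0)` times the density with hazard rate `a`, which has mass `1`.
  have hkey : ∀ x, 0 < x → (∫⁻ u in Set.Ioc 0 x, ENNReal.ofReal (h u)) + D x =
      D 0 + ∫⁻ u in Set.Ioc 0 x, ENNReal.ofReal (a u) := by
    intro x hx
    have h1 : D 0 = (∫⁻ u in Set.Ioc 0 x, ENNReal.ofReal (h u) * (1 - v (ENNReal.ofReal u))) +
        D x := by
      rw [hD]
      simp only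
      rw [← lintegral_union measurableSet_Ioi (Set.Ioc_disjoint_Ioi le_rfl),
        Set.Ioc_union_Ioi_eq_Ioi hx.le]
    have h2 : ∫⁻ u in Set.Ioc 0 x, ENNReal.ofReal (h u) =
        (∫⁻ u in Set.Ioc 0 x, ENNReal.ofReal (h u) * (1 - v (ENNReal.ofReal u))) +
          ∫⁻ u in Set.Ioc 0 x, ENNReal.ofReal (a u) := by
      rw [← lintegral_add_left hgm]
      refine setLIntegral_congr_fun measurableSet_Ioc fun u hu => ?_
      rw [hae u hu.1, ← mul_add, tsub_add_cancel_of_le (hv1 _), mul_one]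
    rw [h1, h2]
    ring
  have h3 := lintegral_Ioi_mul_expNeg ham ha0 hab hainf le_rfl
  calc _ = ∫⁻ x in Set.Ioi 0, expNeg (D 0) * (ENNReal.ofReal (a x) *
        expNeg (∫⁻ u in Set.Ioc 0 x, ENNReal.ofReal (a u))) := by
        refine setLIntegral_congr_fun measurableSet_Ioi fun x hx => ?_
        have h4 : expNeg (D 0) * expNeg (∫⁻ u in Set.Ioc 0 x, ENNReal.ofReal (a u)) =
            expNeg (∫⁻ u in Set.Ioc 0 x, ENNReal.ofReal (h u)) * expNeg (D x) := by
          rw [← expNeg_add, ← expNeg_add, hkey x hx]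
        change _ * (_ * expNeg (D x)) = _
        rw [hae x hx, density, mul_left_comm (expNeg (D 0)), h4]
        ring
    _ = _ := by
        rw [lintegral_const_mul' _ _ (expNeg_ne_top _), h3]
        simp [hD]

end IsHazardRate

/-! ### The self-reinforced offspring process -/

lemma arrivalTime_zero (e : ℕ → ℝ≥0∞) : arrivalTime e 0 = 0 := by simp [arrivalTime]

lemma arrivalTime_succ (e : ℕ → ℝ≥0∞) (n : ℕ) : arrivalTime e (n + 1) = arrivalTime e n + e n :=
  Finset.sum_range_succ _ _

lemma monotone_arrivalTime (e : ℕ → ℝ≥0∞) : Monotone (arrivalTime e) :=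
  monotone_nat_of_le_succ fun n => by rw [arrivalTime_succ]; exact le_self_add

lemma arrivalTime_congr {e e' : ℕ → ℝ≥0∞} {n : ℕ} (h : ∀ j, j < n → e j = e' j) {i : ℕ}
    (hi : i ≤ n) : arrivalTime e i = arrivalTime e' i :=
  Finset.sum_congr rfl fun j hj => h j ((Finset.mem_range.1 hj).trans_le hi)

lemma arrivalTime_ne_top {e : ℕ → ℝ≥0∞} {n : ℕ} (h : ∀ j, j < n → e j ≠ ∞) {i : ℕ} (hi : i ≤ n) :
    arrivalTime e i ≠ ∞ :=
  ENNReal.sum_ne_top.2 fun j hj => h j ((Finset.mem_range.1 hj).trans_le hi)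

lemma measurable_arrivalTime (n : ℕ) : Measurable fun e : ℕ → ℝ≥0∞ => arrivalTime e n :=
  Finset.measurable_sum _ fun i _ => measurable_pi_apply i

/-- The hazard rate of the time to go from `n` to `n + 1` children, when the inter-arrival times are
`e`. -/
def stepRate (δ : ℝ) (e : ℕ → ℝ≥0∞) (n : ℕ) (x : ℝ) : ℝ :=
  hazardRate δ (fun j => (arrivalTime e j).toReal) n x

lemma stepRate_congr (δ : ℝ) {e e' : ℕ → ℝ≥0∞} {n : ℕ} (h : ∀ j, j < n → e j = e' j) :
    stepRate δ e n = stepRate δ e' n := by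
  funext x
  simp only [stepRate, hazardRate]
  rw [arrivalTime_congr h le_rfl]
  congr 2
  exact Finset.sum_congr rfl fun j hj => by rw [arrivalTime_congr h (Finset.mem_Icc.1 hj).2]

lemma measurable_stepRate (δ : ℝ) (n : ℕ) :
    Measurable fun p : (ℕ → ℝ≥0∞) × ℝ => stepRate δ p.1 n p.2 := by
  have h : ∀ j, Measurable fun p : (ℕ → ℝ≥0∞) × ℝ => (arrivalTime p.1 j).toReal := fun j =>
    ((measurable_arrivalTime j).comp measurable_fst).ennreal_toReal
  have h' := h n
  unfold stepRate hazardRate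
  refine Measurable.add (by fun_prop) (Measurable.const_mul ?_ _)
  refine Finset.measurable_sum _ fun j _ => ?_
  have := h j
  fun_prop

lemma stepRate_zero (δ : ℝ) (e : ℕ → ℝ≥0∞) : stepRate δ e 0 = rootRate δ := by
  funext x
  simp [stepRate, hazardRate, rootRate, arrivalTime_zero]

/-- At a birth the existing individuals keep their rates, now `e n` time units older, and the
newborn adds `edgeRate δ` at age `x`. This is the identity that links the reinforced hazard to
branching. Finiteness of the times makes `toReal` additive. -/
lemma stepRate_succ (δ : ℝ) {e : ℕ → ℝ≥0∞} {n : ℕ} (h : ∀ j, j < n + 1 → e j ≠ ∞) (x : ℝ) :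
    stepRate δ e (n + 1) x = stepRate δ e n ((e n).toReal + x) + edgeRate δ x := by
  have hσ : (arrivalTime e (n + 1)).toReal = (arrivalTime e n).toReal + (e n).toReal := by
    rw [arrivalTime_succ, ENNReal.toReal_add (arrivalTime_ne_top h n.le_succ) (h n n.lt_succ_self)]
  simp only [stepRate, hazardRate, edgeRate]
  rw [Finset.sum_Icc_succ_top (by omega), sub_self, zero_add, mul_add, ← add_assoc, hσ]
  congr 2
  · congr 3
    ring
  · congr 1
    refine Finset.sum_congr rfl fun j _ => ?_
    congr 2
    ring

lemma rootRate_nonneg {δ : ℝ} (hδ : -1 < δ) {x : ℝ} (hx : 0 ≤ x) : 0 ≤ rootRate δ x := by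
  have h1 : 0 < (1 + δ) / (1 + δ / 2) := div_pos (by linarith) (by linarith)
  have h2 : Real.exp (-x) ≤ 1 := Real.exp_le_one_iff.2 (by linarith)
  exact mul_nonneg h1.le (by linarith)

lemma edgeRate_nonneg {δ : ℝ} (hδ : -1 < δ) {x : ℝ} (hx : 0 ≤ x) : 0 ≤ edgeRate δ x := by
  have h1 : 0 < 1 / (1 + δ / 2) := div_pos one_pos (by linarith)
  have h2 : Real.exp (-x) ≤ 1 := Real.exp_le_one_iff.2 (by linarith)
  exact mul_nonneg h1.le (by linarith)

/-- Provides a lower bound away from `0`, so that the total hazard is infinite and the next birth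
occurs almost surely. -/
lemma rootRate_le_stepRate {δ : ℝ} (hδ : -1 < δ) {e : ℕ → ℝ≥0∞} {n : ℕ}
    (h : ∀ j, j < n → e j ≠ ∞) {x : ℝ} (hx : 0 ≤ x) : rootRate δ x ≤ stepRate δ e n x := by
  induction n generalizing x with
  | zero => rw [stepRate_zero]
  | succ n ih =>
    have h1 : rootRate δ x ≤ rootRate δ ((e n).toReal + x) := by
      have h1 : 0 < (1 + δ) / (1 + δ / 2) := div_pos (by linarith) (by linarith)
      have h2 : Real.exp (-((e n).toReal + x)) ≤ Real.exp (-x) :=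
        Real.exp_le_exp.2 (by linarith [ENNReal.toReal_nonneg (a := e n)])
      exact mul_le_mul_of_nonneg_left (by linarith) h1.le
    have h2 := ih (fun j hj => h j (hj.trans n.lt_succ_self))
      (add_nonneg (ENNReal.toReal_nonneg (a := e n)) hx)
    rw [stepRate_succ δ h]
    linarith [edgeRate_nonneg hδ hx]

lemma isHazardRate_stepRate {δ : ℝ} (hδ : -1 < δ) {e : ℕ → ℝ≥0∞} {n : ℕ}
    (h : ∀ j, j < n → e j ≠ ∞) : IsHazardRate (stepRate δ e n) where
  continuous := by unfold stepRate hazardRate; fun_prop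
  nonneg x hx := (rootRate_nonneg hδ hx).trans (rootRate_le_stepRate hδ h hx)
  lower := by
    have h1 : 0 < (1 + δ) / (1 + δ / 2) := div_pos (by linarith) (by linarith)
    refine ⟨rootRate δ 1, mul_pos h1 ?_, fun x hx =>
      le_trans ?_ (rootRate_le_stepRate hδ h (zero_le_one.trans hx))⟩
    · have : Real.exp (-1) < 1 := Real.exp_lt_one_iff.2 (by norm_num)
      linarith
    · have h2 : Real.exp (-x) ≤ Real.exp (-1) := Real.exp_le_exp.2 (by linarith)
      exact mul_le_mul_of_nonneg_left (by linarith) h1.le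

/-- The sequence which starts with `p` and is continued by the constant `x`. -/
def glue {n : ℕ} (p : Fin n → ℝ≥0∞) (x : ℝ≥0∞) (j : ℕ) : ℝ≥0∞ :=
  if h : j < n then p ⟨j, h⟩ else x

lemma measurable_glue (n : ℕ) :
    Measurable fun p : (Fin n → ℝ≥0∞) × ℝ≥0∞ => glue p.1 p.2 := by
  refine measurable_pi_iff.2 fun j => ?_
  unfold glue
  split_ifs
  · fun_prop
  · fun_prop

/-! ### The conditional law of the next inter-arrival time -/

namespace IsSelfReinforcedInterarrival

variable {Ω : Type*} [MeasurableSpace Ω] {μ : Measure Ω} {δ : ℝ} {E : Ω → ℕ → ℝ≥0∞}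

lemma measurable_past (hE : IsSelfReinforcedInterarrival δ E μ) (n : ℕ) :
    Measurable fun ω (j : Fin n) => E ω j :=
  measurable_pi_iff.2 fun j => (measurable_pi_apply (j : ℕ)).comp hE.measurable

/-- The hazard condition holds almost surely for each `s`; imposing it at countably many `s`
identifies the whole conditional law. -/
lemma condDistrib_ae_eq [IsProbabilityMeasure μ] (hδ : -1 < δ)
    (hE : IsSelfReinforcedInterarrival δ E μ) {n : ℕ}
    (hfin : ∀ᵐ ω ∂μ, ∀ j, j < n → E ω j ≠ ∞) :
    ∀ᵐ ω ∂μ, condDistrib (fun ω => E ω n) (fun ω (j : Fin n) => E ω j) μ (fun j => E ω j) =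
      IsHazardRate.law (stepRate δ (E ω) n) := by
  have hn : Measurable fun ω => E ω n := (measurable_pi_apply n).comp hE.measurable
  have h1 : ∀ᵐ ω ∂μ, ∀ r : ℚ,
      (condDistrib (fun ω => E ω n) (fun ω (j : Fin n) => E ω j) μ (fun j => E ω j)).real
        (Set.Ioi ((r : ℝ).toNNReal : ℝ≥0∞)) =
      Real.exp (-∫ x in (0 : ℝ)..((r : ℝ).toNNReal : ℝ), stepRate δ (E ω) n x) := by
    refine ae_all_iff.2 fun r => ?_
    filter_upwards [condDistrib_ae_eq_condExp (μ := μ) (hE.measurable_past n) hn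
      (measurableSet_Ioi (a := ((r : ℝ).toNNReal : ℝ≥0∞))), hE.hazard n (r : ℝ).toNNReal]
      with ω h2 h3
    exact h2.trans h3
  filter_upwards [h1, hfin] with ω h2 h3
  have hh := isHazardRate_stepRate hδ h3
  refine hh.eq_law fun r => ?_
  have hr : (0 : ℝ) ≤ ((r : ℝ).toNNReal : ℝ) := NNReal.coe_nonneg _
  rw [← ofReal_measureReal, h2 r, intervalIntegral.integral_of_le hr,
    ← expNeg_ofReal, ofReal_integral_eq_lintegral_ofReal]
  · exact (hh.continuous.integrableOn_Icc).mono_set Set.Ioc_subset_Icc_self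
  · exact (ae_restrict_iff' measurableSet_Ioc).2 (ae_of_all _ fun x hx => hh.nonneg x hx.1.le)
  · exact setIntegral_nonneg measurableSet_Ioc fun x hx => hh.nonneg x hx.1.le

lemma lintegral_eq_of_finite [IsProbabilityMeasure μ] (hδ : -1 < δ)
    (hE : IsSelfReinforcedInterarrival δ E μ) {n : ℕ}
    (hfin : ∀ᵐ ω ∂μ, ∀ j, j < n → E ω j ≠ ∞) {F : (Fin n → ℝ≥0∞) × ℝ≥0∞ → ℝ≥0∞}
    (hF : Measurable F) :
    ∫⁻ ω, F (fun j => E ω j, E ω n) ∂μ =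
      ∫⁻ ω, (∫⁻ x in Set.Ioi 0, IsHazardRate.density (stepRate δ (E ω) n) x *
        F (fun j => E ω j, ENNReal.ofReal x)) ∂μ := by
  have hn : Measurable fun ω => E ω n := (measurable_pi_apply n).comp hE.measurable
  have hp := hE.measurable_past n
  rw [← lintegral_map (g := fun ω => ((fun j => E ω j : Fin n → ℝ≥0∞), E ω n)) hF (hp.prodMk hn),
    ← compProd_map_condDistrib hn.aemeasurable, Measure.lintegral_compProd hF,
    lintegral_map (Measurable.lintegral_kernel_prod_right' hF) hp]
  refine lintegral_congr_ae ?_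
  filter_upwards [hE.condDistrib_ae_eq hδ hfin, hfin] with ω h1 h2
  rw [h1, (isHazardRate_stepRate hδ h2).lintegral_law (F := fun x => F (fun j => E ω j, x))
    (hF.comp measurable_prodMk_left)]

/-- Induction along the sequence: a finite past makes the conditional law one with a density on `(0,
∞)`, which gives no mass to `∞`. -/
lemma ae_ne_top [IsProbabilityMeasure μ] (hδ : -1 < δ)
    (hE : IsSelfReinforcedInterarrival δ E μ) (n : ℕ) : ∀ᵐ ω ∂μ, ∀ j, j < n → E ω j ≠ ∞ := by
  induction n with
  | zero => simp
  | succ n ih =>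
    have hn : Measurable fun ω => E ω n := (measurable_pi_apply n).comp hE.measurable
    have h1 := hE.lintegral_eq_of_finite hδ ih
      (F := fun p => ({∞} : Set ℝ≥0∞).indicator 1 p.2)
      ((measurable_one.indicator (measurableSet_singleton _)).comp measurable_snd)
    simp only [Set.indicator_apply, Set.mem_singleton_iff, ENNReal.ofReal_ne_top, if_false,
      mul_zero, lintegral_zero] at h1
    have h2 : μ {ω | E ω n = ∞} = 0 := by
      refine (lintegral_indicator_one (hn (measurableSet_singleton ∞))).symm.trans (Eq.trans ?_ h1)
      exact lintegral_congr fun ω => by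
        classical simp [Set.indicator_apply]
    have h3 : ∀ᵐ ω ∂μ, E ω n ≠ ∞ := by
      rw [ae_iff]
      simpa using h2
    filter_upwards [ih, h3] with ω h4 h5 j hj
    rcases Nat.lt_succ_iff_lt_or_eq.1 hj with hj | rfl
    · exact h4 j hj
    · exact h5

/-- Since `F` sees only the first `n + 1` coordinates, the constant tail produced by `glue` is
irrelevant. -/
lemma lintegral_eq [IsProbabilityMeasure μ] (hδ : -1 < δ)
    (hE : IsSelfReinforcedInterarrival δ E μ) (n : ℕ) {F : (ℕ → ℝ≥0∞) → ℝ≥0∞}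
    (hF : Measurable F) (hF' : ∀ e e' : ℕ → ℝ≥0∞, (∀ j, j < n + 1 → e j = e' j) → F e = F e') :
    ∫⁻ ω, F (E ω) ∂μ = ∫⁻ ω, (∫⁻ x in Set.Ioi 0, IsHazardRate.density (stepRate δ (E ω) n) x *
        F (glue (fun j : Fin n => E ω j) (ENNReal.ofReal x))) ∂μ := by
  rw [← hE.lintegral_eq_of_finite hδ (hE.ae_ne_top hδ n) (F := fun p => F (glue p.1 p.2))
    (hF.comp (measurable_glue n))]
  refine lintegral_congr fun ω => hF' _ _ fun j hj => ?_
  unfold glue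
  split_ifs with h
  · rfl
  · rw [show j = n by omega]

end IsSelfReinforcedInterarrival

/-! ### A functional with constant expectation along the births -/

/-- The conditional Laplace functional of the births in the edge branching process, given the times
of the first `n` births, which are given by the inter-arrival times `e`; here `q` is the Laplace
functional of the descendants of an individual. -/
def laplaceState (δ : ℝ) (f q : ℝ≥0∞ → ℝ≥0∞) (n : ℕ) (e : ℕ → ℝ≥0∞) : ℝ≥0∞ :=
  expNeg (∑ i ∈ Finset.range (n + 1), f (arrivalTime e i)) *
    expNeg (∫⁻ u in Set.Ioi 0, ENNReal.ofReal (stepRate δ e n u) *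
      (1 - q (arrivalTime e n + ENNReal.ofReal u)))

section LaplaceState

variable {δ : ℝ} {f q : ℝ≥0∞ → ℝ≥0∞}

lemma laplaceState_congr {n : ℕ} {e e' : ℕ → ℝ≥0∞} (h : ∀ j, j < n → e j = e' j) :
    laplaceState δ f q n e = laplaceState δ f q n e' := by
  rw [laplaceState, laplaceState, stepRate_congr δ h, arrivalTime_congr h le_rfl]
  congr 2
  exact Finset.sum_congr rfl fun i hi => by
    rw [arrivalTime_congr h (Nat.lt_succ_iff.1 (Finset.mem_range.1 hi))]

lemma measurable_laplaceState (hf : Measurable f) (hq : Measurable q) (n : ℕ) :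
    Measurable (laplaceState δ f q n) := by
  refine Measurable.mul (measurable_expNeg.comp (Finset.measurable_sum _ fun i _ =>
    hf.comp (measurable_arrivalTime i))) (measurable_expNeg.comp ?_)
  refine Measurable.lintegral_prod_right' (f := fun p : (ℕ → ℝ≥0∞) × ℝ =>
    ENNReal.ofReal (stepRate δ p.1 n p.2) *
      (1 - q (arrivalTime p.1 n + ENNReal.ofReal p.2))) ?_
  exact (ENNReal.measurable_ofReal.comp (measurable_stepRate δ n)).mul (measurable_const.sub
    (hq.comp (((measurable_arrivalTime n).comp measurable_fst).add
      (ENNReal.measurable_ofReal.comp measurable_snd))))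

lemma laplaceState_le (n : ℕ) (e : ℕ → ℝ≥0∞) :
    laplaceState δ f q n e ≤ expNeg (∑ i ∈ Finset.range (n + 1), f (arrivalTime e i)) :=
  mul_le_of_le_one_right' (expNeg_le_one _)

/-- After a birth at delay `x`, the new factor `exp(-f)` and the `edgeRate` part of the new hazard
combine to `q` at the birth time, by the fixed point equation. What remains is the old hazard beyond
`x`. -/
lemma laplaceState_glue (hδ : -1 < δ) (hqm : Measurable q)
    (hq : ∀ s, q s = expNeg (f s) * expNeg (∫⁻ u in Set.Ioi 0, ENNReal.ofReal (edgeRate δ u) *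
      (1 - q (s + ENNReal.ofReal u)))) {n : ℕ} {e : ℕ → ℝ≥0∞} (he : ∀ j, j < n → e j ≠ ∞)
    {x : ℝ} (hx : 0 ≤ x) :
    laplaceState δ f q (n + 1) (glue (fun j : Fin n => e j) (ENNReal.ofReal x)) =
      expNeg (∑ i ∈ Finset.range (n + 1), f (arrivalTime e i)) *
        (q (arrivalTime e n + ENNReal.ofReal x) *
          expNeg (∫⁻ u in Set.Ioi x, ENNReal.ofReal (stepRate δ e n u) *
            (1 - q (arrivalTime e n + ENNReal.ofReal u)))) := by
  set e' := glue (fun j : Fin n => e j) (ENNReal.ofReal x) with he'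
  have h1 : ∀ j, j < n → e' j = e j := fun j hj => by simp [he', glue, hj]
  have h2 : e' n = ENNReal.ofReal x := by simp [he', glue]
  have h3 : ∀ j, j < n + 1 → e' j ≠ ∞ := fun j hj => by
    rcases Nat.lt_succ_iff_lt_or_eq.1 hj with hj | rfl
    · rw [h1 j hj]; exact he j hj
    · rw [h2]; exact ENNReal.ofReal_ne_top
  have h4 : arrivalTime e' (n + 1) = arrivalTime e n + ENNReal.ofReal x := by
    rw [arrivalTime_succ, h2, arrivalTime_congr h1 le_rfl]
  have hh := isHazardRate_stepRate hδ he
  have h5 : ∫⁻ u in Set.Ioi 0, ENNReal.ofReal (stepRate δ e' (n + 1) u) *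
        (1 - q (arrivalTime e' (n + 1) + ENNReal.ofReal u)) =
      (∫⁻ u in Set.Ioi x, ENNReal.ofReal (stepRate δ e n u) *
        (1 - q (arrivalTime e n + ENNReal.ofReal u))) +
      ∫⁻ u in Set.Ioi 0, ENNReal.ofReal (edgeRate δ u) *
        (1 - q (arrivalTime e n + ENNReal.ofReal x + ENNReal.ofReal u)) := by
    have h6 : ∫⁻ u in Set.Ioi x, ENNReal.ofReal (stepRate δ e n u) *
          (1 - q (arrivalTime e n + ENNReal.ofReal u)) =
        ∫⁻ u in Set.Ioi 0, ENNReal.ofReal (stepRate δ e n (x + u)) *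
          (1 - q (arrivalTime e n + ENNReal.ofReal (x + u))) := by
      rw [← (measurePreserving_add_left volume x).setLIntegral_comp_preimage_emb
        (measurableEmbedding_addLeft x) _ (Set.Ioi x)]
      simp
    rw [h6, ← lintegral_add_left]
    · refine setLIntegral_congr_fun measurableSet_Ioi fun u hu => ?_
      have hu : 0 ≤ u := le_of_lt hu
      rw [h4, stepRate_succ δ h3, h2, ENNReal.toReal_ofReal hx, stepRate_congr δ h1,
        ENNReal.ofReal_add (hh.nonneg _ (add_nonneg hx hu)) (edgeRate_nonneg hδ hu), add_mul,
        ENNReal.ofReal_add hx hu, add_assoc]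
    · refine Measurable.mul ?_ (measurable_const.sub (hqm.comp (by fun_prop)))
      exact ENNReal.measurable_ofReal.comp (hh.continuous.measurable.comp (by fun_prop))
  rw [laplaceState, h5, Finset.sum_range_succ, expNeg_add, expNeg_add, h4,
    hq (arrivalTime e n + ENNReal.ofReal x),
    Finset.sum_congr rfl fun i hi => by
      rw [arrivalTime_congr h1 (Nat.lt_succ_iff.1 (Finset.mem_range.1 hi))]]
  ring

end LaplaceState

/-- A nonincreasing test function on `[0, ∞]` which is bounded below by `1` on an initial segment
and vanishes afterwards. -/
structure IsTestFunction (f : ℝ≥0∞ → ℝ≥0∞) : Prop where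
  antitone : Antitone f
  vanish : ∃ T : ℝ≥0, ∀ x, (T : ℝ≥0∞) < x → f x = 0
  eq_zero_or_one_le : ∀ x, f x = 0 ∨ 1 ≤ f x

lemma IsTestFunction.top {f : ℝ≥0∞ → ℝ≥0∞} (hf : IsTestFunction f) : f ∞ = 0 := by
  obtain ⟨T, hT⟩ := hf.vanish
  exact hT _ ENNReal.coe_lt_top

lemma lintegral_intensityMeasure {r : ℝ → ℝ} (hr : Continuous r) {F : ℝ → ℝ≥0∞}
    (hF : Measurable F) :
    ∫⁻ u, F u ∂(intensityMeasure r) = ∫⁻ u in Set.Ioi 0, ENNReal.ofReal (r u) * F u := by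
  rw [intensityMeasure, restrict_Ioi_eq_restrict_Ici]
  exact lintegral_withDensity_eq_lintegral_mul _
    (ENNReal.measurable_ofReal.comp hr.measurable) hF

instance (r : ℝ → ℝ) : SigmaFinite (intensityMeasure r) :=
  SigmaFinite.withDensity_ofReal _

lemma continuous_rootRate (δ : ℝ) : Continuous (rootRate δ) := by unfold rootRate; fun_prop

lemma continuous_edgeRate (δ : ℝ) : Continuous (edgeRate δ) := by unfold edgeRate; fun_prop

namespace IsSelfReinforcedInterarrival

variable {Ω : Type*} [MeasurableSpace Ω] {μ : Measure Ω} {δ : ℝ} {E : Ω → ℕ → ℝ≥0∞}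
  {f : ℝ≥0∞ → ℝ≥0∞}

/-- Integrating out the next inter-arrival time returns the previous state: this is the thinning
identity with `v x = q (σ_n + x)`, where a point is kept with probability `1 - v`. At `n = 0` the
hazard is `rootRate δ`. -/
lemma lintegral_laplaceState [IsProbabilityMeasure μ] (hδ : -1 < δ)
    (hE : IsSelfReinforcedInterarrival δ E μ) (hf : IsTestFunction f) (n : ℕ) :
    ∫⁻ ω, laplaceState δ f (laplaceLimit (intensityMeasure (edgeRate δ)) f) n (E ω) ∂μ =
      expNeg (f 0) * expNeg (∫⁻ u, (1 - laplaceLimit (intensityMeasure (edgeRate δ)) f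
        (ENNReal.ofReal u)) ∂(intensityMeasure (rootRate δ))) := by
  set q := laplaceLimit (intensityMeasure (edgeRate δ)) f with hq
  have hfm := hf.antitone.measurable
  have hqm : Measurable q := measurable_laplaceLimit hfm
  have hqF : ∀ s : ℝ≥0∞, Measurable fun u : ℝ => 1 - q (s + ENNReal.ofReal u) := fun s =>
    measurable_const.sub (hqm.comp (by fun_prop))
  have hq' : ∀ s, q s = expNeg (f s) * expNeg (∫⁻ u in Set.Ioi 0,
      ENNReal.ofReal (edgeRate δ u) * (1 - q (s + ENNReal.ofReal u))) := fun s => by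
    rw [← lintegral_intensityMeasure (continuous_edgeRate δ) (hqF s)]
    exact laplaceLimit_eq hfm s
  obtain ⟨T, hT⟩ := hf.vanish
  induction n with
  | zero =>
    have h0 := hqF 0
    simp only [zero_add] at h0
    simp [laplaceState, stepRate_zero, arrivalTime_zero,
      lintegral_intensityMeasure (continuous_rootRate δ) h0]
  | succ n ih =>
    rw [← ih, hE.lintegral_eq hδ n (measurable_laplaceState hfm hqm (n + 1))
      fun e e' h => laplaceState_congr h]
    refine lintegral_congr_ae ?_
    filter_upwards [hE.ae_ne_top hδ n] with ω hω
    have hh := isHazardRate_stepRate hδ hω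
    rw [setLIntegral_congr_fun measurableSet_Ioi fun x hx => by
      rw [laplaceState_glue hδ hqm hq' hω (le_of_lt hx), mul_left_comm],
      lintegral_const_mul' _ _ (expNeg_ne_top _),
      hh.lintegral_law_thinning (v := fun x => q (arrivalTime (E ω) n + x)) (T := T)
        (hqm.comp (by fun_prop)) (fun x => laplaceLimit_le_one _)]
    · rfl
    · exact fun x hx => laplaceLimit_eq_one fun t ht =>
        hT t (hx.trans_le (le_add_self.trans ht))

/-- The Laplace functional of the self-reinforced offspring process. -/
theorem lintegral_expNeg_tsum_arrivalTime [IsProbabilityMeasure μ] (hδ : -1 < δ)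
    (hE : IsSelfReinforcedInterarrival δ E μ) (hf : IsTestFunction f) :
    ∫⁻ ω, expNeg (∑' i, f (arrivalTime (E ω) i)) ∂μ =
      expNeg (f 0) * expNeg (∫⁻ u, (1 - laplaceLimit (intensityMeasure (edgeRate δ)) f
        (ENNReal.ofReal u)) ∂(intensityMeasure (rootRate δ))) := by
  set q := laplaceLimit (intensityMeasure (edgeRate δ)) f with hq
  have hfm := hf.antitone.measurable
  have hqm : Measurable q := measurable_laplaceLimit hfm
  have h1 : Tendsto (fun n => ∫⁻ ω, laplaceState δ f q n (E ω) ∂μ) atTop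
      (𝓝 (∫⁻ ω, expNeg (∑' i, f (arrivalTime (E ω) i)) ∂μ)) := by
    refine tendsto_lintegral_of_dominated_convergence (fun _ => 1)
      (fun n => (measurable_laplaceState hfm hqm n).comp hE.measurable)
      (fun n => ae_of_all _ fun ω => (laplaceState_le _ _).trans (expNeg_le_one _)) (by simp)
      (ae_of_all _ fun ω => ?_)
    have h2 : Tendsto (fun n => expNeg (∑ i ∈ Finset.range (n + 1), f (arrivalTime (E ω) i))) atTop
        (𝓝 (expNeg (∑' i, f (arrivalTime (E ω) i)))) := by
      have := (tendsto_expNeg_sum_range fun i => f (arrivalTime (E ω) i)).comp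
        (tendsto_add_atTop_nat 1)
      simpa [Function.comp_def, expNeg_sum] using this
    -- Either some point lies where `f` has vanished, and then the predictive factor is `1` from
    -- that index on; or `f ≥ 1` at every point, and both sides tend to `0`. Explosion therefore
    -- needs no separate exclusion.
    by_cases h0 : ∃ m, f (arrivalTime (E ω) m) = 0
    · obtain ⟨m, hm⟩ := h0
      refine h2.congr' ?_
      filter_upwards [eventually_ge_atTop m] with n hn
      have hq1 : ∀ u, q (arrivalTime (E ω) n + u) = 1 := fun u =>
        laplaceLimit_eq_one fun t ht => le_antisymm (hm ▸ hf.antitone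
          ((monotone_arrivalTime (E ω) hn).trans (le_self_add.trans ht))) zero_le
      simp [laplaceState, hq1]
    · push Not at h0
      have h3 : ∑' i, f (arrivalTime (E ω) i) = ∞ := by
        refine top_le_iff.1 ?_
        calc ∞ = ∑' _ : ℕ, (1 : ℝ≥0∞) := by simp
          _ ≤ _ := ENNReal.tsum_le_tsum fun i => (hf.eq_zero_or_one_le _).resolve_left (h0 i)
      rw [h3, expNeg_top] at h2 ⊢
      exact tendsto_of_tendsto_of_tendsto_of_le_of_le tendsto_const_nhds h2
        (fun _ => zero_le) fun n => laplaceState_le _ _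
  simp_rw [hq, hE.lintegral_laplaceState hδ hf] at h1
  exact tendsto_nhds_unique h1 tendsto_const_nhds

end IsSelfReinforcedInterarrival

lemma IsEdgeBranching.isPoissonBranching {Ω : Type*} [MeasurableSpace Ω] {μ : Measure Ω} {δ : ℝ}
    {ξ : Ω → List ℕ → ℕ → ℝ≥0∞} (h : IsEdgeBranching δ ξ μ) :
    IsPoissonBranching (intensityMeasure (rootRate δ)) (intensityMeasure (edgeRate δ)) ξ μ :=
  ⟨h.root, h.nonroot, h.indep⟩

/-! ### Laws of counting processes -/

section ENatVectors

variable {I : Type*}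

/-- The map `x ↦ e ^ (-x)` on vectors of extended natural numbers. -/
def expNegVector (x : I → ℕ∞) (t : I) : unitInterval :=
  ⟨(expNeg (x t)).toReal, ENNReal.toReal_nonneg,
    ENNReal.toReal_le_of_le_ofReal zero_le_one (by simpa using expNeg_le_one _)⟩

lemma measurable_expNegVector : Measurable (expNegVector (I := I)) :=
  measurable_pi_iff.2 fun t => Measurable.subtype_mk (Measurable.comp
    (g := fun n : ℕ∞ => (expNeg n).toReal) Measurable.of_discrete (measurable_pi_apply t))

lemma expNegVector_injective : Function.Injective (expNegVector (I := I)) := by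
  intro x y h
  funext t
  have h1 := congrArg Subtype.val (congrFun h t)
  have h2 := (ENNReal.toReal_eq_toReal_iff' (expNeg_ne_top _) (expNeg_ne_top _)).1 h1
  exact ENat.toENNReal_inj.1 (expNeg_injective h2)

variable [Fintype I]

/-- The coordinate functions on the cube. -/
def cubeCoord (t : I) : BoundedContinuousFunction (I → unitInterval) ℝ :=
  BoundedContinuousFunction.mkOfCompact ⟨fun x => (x t : ℝ), by fun_prop⟩

/-- The algebra of polynomial functions on the cube. -/
def cubePolynomials (I : Type*) [Fintype I] :
    StarSubalgebra ℝ (BoundedContinuousFunction (I → unitInterval) ℝ) where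
  toSubalgebra := Algebra.adjoin ℝ (Set.range cubeCoord)
  star_mem' := by
    intro g hg
    have : star g = g := by ext x; simp
    rwa [this]

lemma integral_monomial_map_expNegVector (P : Measure (I → ℕ∞)) (l : I → ℕ) :
    ∫ x, ∏ t, (x t : ℝ) ^ l t ∂(P.map expNegVector) =
      (∫⁻ x, expNeg (∑ t, (l t : ℝ≥0∞) * (x t : ℝ≥0∞)) ∂P).toReal := by
  rw [integral_map measurable_expNegVector.aemeasurable
    (Continuous.aestronglyMeasurable (by fun_prop)), ← integral_toReal]
  · refine integral_congr_ae (ae_of_all _ fun x => ?_)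
    simp only [expNeg_sum, expNeg_nat_mul, ENNReal.toReal_prod, ENNReal.toReal_pow]
    rfl
  · refine (measurable_expNeg.comp (Finset.measurable_sum _ fun t _ => ?_)).aemeasurable
    exact Measurable.comp (g := fun n : ℕ∞ => (l t : ℝ≥0∞) * (n : ℝ≥0∞)) Measurable.of_discrete
      (measurable_pi_apply t)
  · exact ae_of_all _ fun x => (expNeg_ne_top _).lt_top

/-- The law of a vector of extended natural numbers is determined by its Laplace transform. -/
lemma measure_ext_of_laplace {P Q : Measure (I → ℕ∞)} [IsProbabilityMeasure P]
    [IsProbabilityMeasure Q]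
    (h : ∀ l : I → ℕ, ∫⁻ x, expNeg (∑ t, (l t : ℝ≥0∞) * (x t : ℝ≥0∞)) ∂P =
      ∫⁻ x, expNeg (∑ t, (l t : ℝ≥0∞) * (x t : ℝ≥0∞)) ∂Q) : P = Q := by
  have hP := Measure.isProbabilityMeasure_map (μ := P) measurable_expNegVector.aemeasurable
  have hQ := Measure.isProbabilityMeasure_map (μ := Q) measurable_expNegVector.aemeasurable
  have key : P.map expNegVector = Q.map expNegVector := by
    refine ext_of_forall_mem_subalgebra_integral_eq_of_polish (𝕜 := ℝ) (A := cubePolynomials I)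
      ?_ ?_
    · intro x y hxy
      obtain ⟨t, ht⟩ := Function.ne_iff.1 hxy
      refine ⟨_, ⟨_, ⟨cubeCoord t, Algebra.subset_adjoin ⟨t, rfl⟩, rfl⟩, rfl⟩, ?_⟩
      simpa [cubeCoord] using fun hc => ht (Subtype.ext hc)
    · intro g hg
      -- The polynomial algebra is the linear span of the monomials, whose integrals are the given
      -- Laplace transforms.
      have hg' : g ∈ Submodule.span ℝ (Submonoid.closure (Set.range (cubeCoord (I := I))) :
          Set (BoundedContinuousFunction (I → unitInterval) ℝ)) := by
        rw [← Algebra.adjoin_eq_span]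
        exact hg
      clear hg
      induction hg' using Submodule.span_induction with
      | mem g hg =>
        have hmon : ∃ l : I → ℕ, ∀ x, g x = ∏ t, (x t : ℝ) ^ l t := by
          induction hg using Submonoid.closure_induction with
          | mem g hg =>
            classical
            obtain ⟨t, rfl⟩ := hg
            refine ⟨Pi.single t 1, fun x => ?_⟩
            rw [Finset.prod_eq_single t]
            · simp [cubeCoord]
            · intro s _ hs
              simp [hs]
            · simp
          | one => exact ⟨0, fun x => by simp⟩
          | mul g g' _ _ ih ih' =>
            obtain ⟨l, hl⟩ := ih
            obtain ⟨l', hl'⟩ := ih'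
            exact ⟨l + l', fun x => by simp [hl, hl', pow_add, Finset.prod_mul_distrib]⟩
        obtain ⟨l, hl⟩ := hmon
        simp_rw [hl, integral_monomial_map_expNegVector, h]
      | zero => simp
      | add g g' _ _ ih ih' =>
        simp only [BoundedContinuousFunction.coe_add, Pi.add_apply]
        rw [integral_add (g.integrable _) (g'.integrable _),
          integral_add (g.integrable _) (g'.integrable _), ih, ih']
      | smul c g _ ih =>
        simp only [BoundedContinuousFunction.coe_smul]
        rw [integral_smul, integral_smul, ih]
  -- The space of vectors is countable and its embedding in the cube is injective, so equality of
  -- the image measures passes to singletons.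
  refine Measure.ext_of_singleton fun x => ?_
  have hpre : expNegVector ⁻¹' {expNegVector x} = {x} := by
    ext y
    simp [expNegVector_injective.eq_iff]
  have h1 := congrArg (fun m : Measure (I → unitInterval) => m {expNegVector x}) key
  simpa only [Measure.map_apply measurable_expNegVector (measurableSet_singleton _), hpre] using h1

end ENatVectors

lemma toENNReal_encard_le {ι : Type*} (b : ι → ℝ≥0∞) (t : ℝ≥0∞) :
    ({i | b i ≤ t}.encard : ℝ≥0∞) = ∑' i, if b i ≤ t then 1 else 0 := by
  classical
  rw [← ENNReal.tsum_set_one, tsum_subtype _ (fun _ => (1 : ℝ≥0∞))]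
  exact tsum_congr fun i => by simp [Set.indicator_apply]

lemma measurable_encard_le (ι : Type*) [Countable ι] :
    Measurable fun p : (ι → ℝ≥0∞) × ℝ≥0∞ => {i | p.1 i ≤ p.2}.encard := by
  have h : Measurable fun p : (ι → ℝ≥0∞) × ℝ≥0∞ => ({i | p.1 i ≤ p.2}.encard : ℝ≥0∞) := by
    simp_rw [toENNReal_encard_le]
    refine Measurable.tsum fun i => Measurable.ite ?_ measurable_const measurable_const
    exact measurableSet_le ((measurable_pi_apply i).comp measurable_fst) measurable_snd
  refine measurable_to_countable' fun n => ?_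
  have : (fun p : (ι → ℝ≥0∞) × ℝ≥0∞ => {i | p.1 i ≤ p.2}.encard) ⁻¹' {n} =
      (fun p : (ι → ℝ≥0∞) × ℝ≥0∞ => ({i | p.1 i ≤ p.2}.encard : ℝ≥0∞)) ⁻¹' {(n : ℝ≥0∞)} := by
    ext p
    simp
  rw [this]
  exact h (measurableSet_singleton _)

/-- The test function which counts the points up to the times `t ∈ I` with the multiplicities
`l t`. -/
def countingTest (I : Finset ℝ≥0) (l : I → ℕ) (x : ℝ≥0∞) : ℝ≥0∞ :=
  ∑ t : I, (l t : ℝ≥0∞) * if x ≤ (t : ℝ≥0) then 1 else 0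

lemma isTestFunction_countingTest (I : Finset ℝ≥0) (l : I → ℕ) :
    IsTestFunction (countingTest I l) where
  antitone x y hxy := by
    refine Finset.sum_le_sum fun t _ => mul_le_mul_right ?_ _
    by_cases h : y ≤ (t : ℝ≥0)
    · simp [h, hxy.trans h]
    · simp [h]
  vanish := by
    refine ⟨I.sup id, fun x hx => Finset.sum_eq_zero fun t _ => ?_⟩
    have h1 : ((t : ℝ≥0) : ℝ≥0∞) ≤ ((I.sup id : ℝ≥0) : ℝ≥0∞) :=
      ENNReal.coe_le_coe.2 (Finset.le_sup (f := id) t.2)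
    simp [not_le.2 (h1.trans_lt hx)]
  eq_zero_or_one_le x := by
    -- Integer multiplicities make the values natural numbers, hence `0` or at least `1`.
    have h : countingTest I l x = ((∑ t : I, l t * if x ≤ (t : ℝ≥0) then 1 else 0 : ℕ) : ℝ≥0∞) := by
      simp [countingTest]
    rw [h]
    rcases Nat.eq_zero_or_pos (∑ t : I, l t * if x ≤ (t : ℝ≥0) then 1 else 0) with h0 | h0
    · exact Or.inl (by rw [h0]; simp)
    · exact Or.inr (by exact_mod_cast h0)

lemma tsum_countingTest {ι : Type*} (I : Finset ℝ≥0) (l : I → ℕ) (b : ι → ℝ≥0∞) :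
    ∑' i, countingTest I l (b i) =
      ∑ t : I, (l t : ℝ≥0∞) * ({i | b i ≤ (t : ℝ≥0)}.encard : ℝ≥0∞) := by
  simp_rw [toENNReal_encard_le, ← ENNReal.tsum_mul_left]
  rw [← Summable.tsum_finsetSum fun _ _ => ENNReal.summable]
  rfl

section Counting

variable {Ω Ω' ι ι' : Type*} [MeasurableSpace Ω] [MeasurableSpace Ω'] {μ : Measure Ω}
  {μ' : Measure Ω'} [IsProbabilityMeasure μ] [IsProbabilityMeasure μ'] [Countable ι] [Countable ι']
  {b : Ω → ι → ℝ≥0∞} {b' : Ω' → ι' → ℝ≥0∞}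

/-- Counting tests encode the Laplace transforms of the finite-dimensional distributions, and a
measure on the product space is determined by these as a projective limit. -/
lemma identDistrib_encard_le (hb : Measurable b) (hb' : Measurable b')
    (h : ∀ f, IsTestFunction f →
      ∫⁻ ω, expNeg (∑' i, f (b ω i)) ∂μ = ∫⁻ ω, expNeg (∑' i, f (b' ω i)) ∂μ') :
    IdentDistrib (fun ω (t : ℝ≥0) => {i | b ω i ≤ t}.encard)
      (fun ω (t : ℝ≥0) => {i | b' ω i ≤ t}.encard) μ μ' := by
  have hm : Measurable fun ω (t : ℝ≥0) => {i | b ω i ≤ t}.encard := measurable_pi_iff.2 fun t =>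
    (measurable_encard_le ι).comp (hb.prodMk measurable_const)
  have hm' : Measurable fun ω (t : ℝ≥0) => {i | b' ω i ≤ t}.encard := measurable_pi_iff.2 fun t =>
    (measurable_encard_le ι').comp (hb'.prodMk measurable_const)
  refine ⟨hm.aemeasurable, hm'.aemeasurable, ?_⟩
  have h1 := isProjectiveLimit_map (P := μ) (X := fun (t : ℝ≥0) ω => {i | b ω i ≤ t}.encard)
    hm.aemeasurable
  have h2 := isProjectiveLimit_map (P := μ') (X := fun (t : ℝ≥0) ω => {i | b' ω i ≤ t}.encard)
    hm'.aemeasurable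
  have hfam : ∀ I : Finset ℝ≥0, IsProbabilityMeasure
      (μ.map fun ω => I.restrict fun t : ℝ≥0 => {i | b ω i ≤ t}.encard) := fun I =>
    Measure.isProbabilityMeasure_map ((Finset.measurable_restrict I).comp hm).aemeasurable
  refine h1.unique fun I => ?_
  rw [h2 I]
  have := hfam I
  have : IsProbabilityMeasure (μ'.map fun ω => I.restrict fun t : ℝ≥0 => {i | b' ω i ≤ t}.encard) :=
    Measure.isProbabilityMeasure_map ((Finset.measurable_restrict I).comp hm').aemeasurable
  refine measure_ext_of_laplace fun l => ?_
  have hF : Measurable fun x : I → ℕ∞ => expNeg (∑ t, (l t : ℝ≥0∞) * (x t : ℝ≥0∞)) :=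
    measurable_expNeg.comp (Finset.measurable_sum _ fun t _ =>
      Measurable.comp (g := fun n : ℕ∞ => (l t : ℝ≥0∞) * (n : ℝ≥0∞)) Measurable.of_discrete
        (measurable_pi_apply t))
  have h3 := h _ (isTestFunction_countingTest I l)
  simp_rw [tsum_countingTest] at h3
  exact ((lintegral_map hF ((Finset.measurable_restrict I).comp hm')).trans h3.symm).trans
    (lintegral_map hF ((Finset.measurable_restrict I).comp hm)).symm

lemma lintegral_indicator_encard_le_random (hb : Measurable b) {T : Ω → ℝ≥0}
    (hT : AEMeasurable T μ) (hind : IndepFun T b μ) (s : Set ℕ∞) :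
    ∫⁻ ω, s.indicator 1 {i | b ω i ≤ T ω}.encard ∂μ =
      ∫⁻ t, (∫⁻ ω, s.indicator 1 {i | b ω i ≤ (t : ℝ≥0)}.encard ∂μ) ∂(μ.map T) := by
  have hs : Measurable (s.indicator (1 : ℕ∞ → ℝ≥0∞)) := Measurable.of_discrete
  have hF : Measurable (Function.uncurry fun (t : ℝ≥0) (x : ι → ℝ≥0∞) =>
      s.indicator (1 : ℕ∞ → ℝ≥0∞) {i | x i ≤ t}.encard) :=
    hs.comp ((measurable_encard_le ι).comp
      (measurable_snd.prodMk (measurable_coe_nnreal_ennreal.comp measurable_fst)))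
  rw [hind.lintegral_comp_prodMk hT hb.aemeasurable hF, lintegral_map' _ hT]
  refine Measurable.aemeasurable (Measurable.lintegral_prod_right' (f := fun p : ℝ≥0 × Ω =>
    s.indicator (1 : ℕ∞ → ℝ≥0∞) {i | b p.2 i ≤ p.1}.encard) ?_)
  exact hF.comp (measurable_fst.prodMk (hb.comp measurable_snd))

/-- Conditioning on the independent time leaves an integral, over the law of `T`, of the
one-dimensional marginals at fixed times. -/
lemma identDistrib_encard_le_random (hb : Measurable b) (hb' : Measurable b') {T : Ω → ℝ≥0}
    {T' : Ω' → ℝ≥0} (hT : IdentDistrib T T' μ μ') (hind : IndepFun T b μ)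
    (hind' : IndepFun T' b' μ') (h : IdentDistrib (fun ω (t : ℝ≥0) => {i | b ω i ≤ t}.encard)
      (fun ω (t : ℝ≥0) => {i | b' ω i ≤ t}.encard) μ μ') :
    IdentDistrib (fun ω => {i | b ω i ≤ T ω}.encard) (fun ω => {i | b' ω i ≤ T' ω}.encard)
      μ μ' := by
  have hm : AEMeasurable (fun ω => {i | b ω i ≤ T ω}.encard) μ :=
    (measurable_encard_le ι).comp_aemeasurable (hb.aemeasurable.prodMk
      hT.aemeasurable_fst.coe_nnreal_ennreal)
  have hm' : AEMeasurable (fun ω => {i | b' ω i ≤ T' ω}.encard) μ' :=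
    (measurable_encard_le ι').comp_aemeasurable (hb'.aemeasurable.prodMk
      hT.aemeasurable_snd.coe_nnreal_ennreal)
  refine ⟨hm, hm', ?_⟩
  ext s hs
  have hs' : Measurable (s.indicator (1 : ℕ∞ → ℝ≥0∞)) := Measurable.of_discrete
  rw [← lintegral_indicator_one hs, ← lintegral_indicator_one hs,
    lintegral_map' hs'.aemeasurable hm, lintegral_map' hs'.aemeasurable hm',
    lintegral_indicator_encard_le_random hb hT.aemeasurable_fst hind,
    lintegral_indicator_encard_le_random hb' hT.aemeasurable_snd hind', hT.map_eq]
  exact lintegral_congr fun t => (h.comp (hs'.comp (measurable_pi_apply t))).lintegral_eq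

end Counting

/-! ### Birth times as functionals of the counting process -/

lemma offspringCount_add_one (e : ℕ → ℝ≥0∞) (t : ℝ≥0) :
    offspringCount e t + 1 = {i | arrivalTime e i ≤ t}.encard := by
  have : {i | arrivalTime e i ≤ t} = insert 0 {i : ℕ | 1 ≤ i ∧ arrivalTime e i ≤ t} := by
    ext i
    rcases Nat.eq_zero_or_pos i with rfl | hi
    · simp [arrivalTime_zero]
    · simp [hi.ne', Nat.one_le_iff_ne_zero]
  rw [this, Set.encard_insert_of_notMem (by simp), offspringCount]

/-- By monotonicity the indices form an initial segment of `ℕ`; it includes `0`, whence the `+ 1`.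
-/
lemma le_encard_arrivalTime_iff (e : ℕ → ℝ≥0∞) (t : ℝ≥0∞) (m : ℕ) :
    (m : ℕ∞) + 1 ≤ {i | arrivalTime e i ≤ t}.encard ↔ arrivalTime e m ≤ t := by
  constructor
  · intro h
    by_contra hc
    have hsub : {i | arrivalTime e i ≤ t} ⊆ (Finset.range m : Set ℕ) := by
      intro i hi
      by_contra hmi
      have hmi : m ≤ i := by simpa using hmi
      exact hc ((monotone_arrivalTime e hmi).trans hi)
    have := h.trans (Set.encard_le_encard hsub)
    rw [Set.encard_coe_eq_coe_finsetCard, Finset.card_range] at this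
    have : m + 1 ≤ m := by exact_mod_cast this
    omega
  · intro h
    have hsub : (Finset.range (m + 1) : Set ℕ) ⊆ {i | arrivalTime e i ≤ t} := by
      intro i hi
      have hi : i < m + 1 := by simpa using hi
      exact (monotone_arrivalTime e (Nat.lt_succ_iff.1 hi)).trans h
    have := Set.encard_le_encard hsub
    rw [Set.encard_coe_eq_coe_finsetCard, Finset.card_range] at this
    exact_mod_cast this

lemma offspringCount_add_one_eq_iff (e : ℕ → ℝ≥0∞) (t : ℝ≥0) (k : ℕ) :
    offspringCount e t + 1 = (k : ℕ∞) + 1 ↔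
      arrivalTime e k ≤ t ∧ t < arrivalTime e (k + 1) := by
  rw [← not_le, ← le_encard_arrivalTime_iff, ← le_encard_arrivalTime_iff, offspringCount_add_one,
    not_le, le_antisymm_iff, and_comm]
  refine and_congr_right fun _ => ?_
  have h : ((k + 1 : ℕ) : ℕ∞) + 1 = ((k : ℕ∞) + 1) + 1 := by push_cast; rfl
  rw [h]
  exact (ENat.lt_add_one_iff (by exact_mod_cast ENat.natCast_ne_top (k + 1))).symm

/-- The first times at which a counting process reaches the levels `2, 3, ...`. -/
def levelTime (N : ℝ≥0 → ℕ∞) (k : ℕ) : ℝ≥0∞ :=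
  ⨅ r : ℚ, if (k : ℕ∞) + 2 ≤ N (r : ℝ).toNNReal then ((r : ℝ).toNNReal : ℝ≥0∞) else ∞

lemma measurable_levelTime : Measurable levelTime := by
  refine measurable_pi_iff.2 fun k => Measurable.iInf fun r => ?_
  have h : MeasurableSet ((fun N : ℝ≥0 → ℕ∞ => N (r : ℝ).toNNReal) ⁻¹' Set.Ici ((k : ℕ∞) + 2)) :=
    measurable_pi_apply (r : ℝ).toNNReal .of_discrete
  exact Measurable.ite h measurable_const measurable_const

/-- The count is monotone in time, so rational times give the same infimum. The countable form is
what makes `levelTime` measurable on the product space. -/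
lemma levelTime_encard {ι : Type*} (b : ι → ℝ≥0∞) (k : ℕ) :
    levelTime (fun t => {i | b i ≤ t}.encard) k =
      sInf {t : ℝ≥0∞ | (k : ℕ∞) + 2 ≤ {i | b i ≤ t}.encard} := by
  refine le_antisymm (le_sInf fun t ht => le_of_forall_gt fun c hc => ?_) (le_iInf fun r => ?_)
  · obtain ⟨r, _, h1, h2⟩ := ENNReal.lt_iff_exists_rat_btwn.1 hc
    refine (iInf_le _ r).trans_lt ?_
    rw [if_pos]
    · exact h2
    · exact le_trans ht (Set.encard_le_encard fun i hi => le_trans hi h1.le)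
  · split_ifs with h
    · exact sInf_le h
    · exact le_top

lemma levelTime_populationSize (ξ : List ℕ → ℕ → ℝ≥0∞) :
    levelTime (fun t => populationSize ξ t) = fun k => successiveBirthTime ξ k :=
  funext fun k => levelTime_encard (birthTime ξ) k

lemma levelTime_offspringCount (e : ℕ → ℝ≥0∞) :
    levelTime (fun t => offspringCount e t + 1) = fun k => arrivalTime e (k + 1) := by
  funext k
  simp_rw [offspringCount_add_one]
  rw [levelTime_encard]
  have : {t : ℝ≥0∞ | (k : ℕ∞) + 2 ≤ {i | arrivalTime e i ≤ t}.encard} =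
      Set.Ici (arrivalTime e (k + 1)) := by
    ext t
    rw [Set.mem_Ici, ← le_encard_arrivalTime_iff]
    push_cast
    rw [add_assoc, one_add_one_eq_two]
    rfl
  rw [this, csInf_Ici]

lemma measurable_successiveBirthTime :
    Measurable fun (ξ : List ℕ → ℕ → ℝ≥0∞) k => successiveBirthTime ξ k := by
  simp_rw [← levelTime_populationSize]
  refine measurable_levelTime.comp (measurable_pi_iff.2 fun t => ?_)
  exact (measurable_encard_le (List ℕ)).comp
    ((measurable_pi_iff.2 measurable_birthTime).prodMk measurable_const)

lemma measurable_population :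
    Measurable fun (ξ : List ℕ → ℕ → ℝ≥0∞) (t : ℝ≥0) => population ξ t :=
  measurable_pi_iff.2 fun _ => measurable_set_iff.2 fun w =>
    (measurableSet_le (measurable_birthTime w) measurable_const).mem

/-- The number of children in the self-reinforced offspring process, increased by `1`, has the same
law as the size of the edge branching process. -/
theorem identDistrib_offspringCount {Ω Ω' : Type*} [MeasurableSpace Ω] [MeasurableSpace Ω']
    {μ : Measure Ω} {μ' : Measure Ω'} [IsProbabilityMeasure μ] [IsProbabilityMeasure μ'] {δ : ℝ}
    (hδ : -1 < δ) {E : Ω → ℕ → ℝ≥0∞} {ξ : Ω' → List ℕ → ℕ → ℝ≥0∞}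
    (hE : IsSelfReinforcedInterarrival δ E μ) (hξ : IsEdgeBranching δ ξ μ') :
    IdentDistrib (fun ω (t : ℝ≥0) => offspringCount (E ω) t + 1)
      (fun ω (t : ℝ≥0) => populationSize (ξ ω) t) μ μ' := by
  simp_rw [offspringCount_add_one]
  refine identDistrib_encard_le (b := fun ω i => arrivalTime (E ω) i)
    (b' := fun ω w => birthTime (ξ ω) w)
    (measurable_pi_iff.2 fun i => (measurable_arrivalTime i).comp hE.measurable)
    (measurable_pi_iff.2 fun w => (measurable_birthTime w).comp hξ.isPoissonBranching.measurable)
    fun f hf => ?_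
  rw [hE.lintegral_expNeg_tsum_arrivalTime hδ hf,
    hξ.isPoissonBranching.lintegral_expNeg_tsum_birthTime hf.antitone.measurable hf.top]

end

end SelfReinforcement

/-! ### The three statements of the proposition -/

theorem proposition4p2 (δ : ℝ) (hδ : -1 < δ) :
    -- equality in law of the counting processes
    (∀ (Ω : Type u) (Ω' : Type v) [MeasurableSpace Ω] [MeasurableSpace Ω']
      (μ : Measure Ω) (μ' : Measure Ω') [IsProbabilityMeasure μ] [IsProbabilityMeasure μ']
      (E : Ω → ℕ → ℝ≥0∞) (ξ : Ω' → List ℕ → ℕ → ℝ≥0∞),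
      IsSelfReinforcedInterarrival δ E μ → IsEdgeBranching δ ξ μ' →
      IdentDistrib (fun ω (t : ℝ≥0) => offspringCount (E ω) t + 1)
        (fun ω (t : ℝ≥0) => populationSize (ξ ω) t) μ μ') ∧
    -- equality in law of the branching processes with these offspring processes
    (∀ (Ω : Type u) (Ω' : Type v) [MeasurableSpace Ω] [MeasurableSpace Ω']
      (μ : Measure Ω) (μ' : Measure Ω') [IsProbabilityMeasure μ] [IsProbabilityMeasure μ']
      (E : Ω → List ℕ → ℕ → ℝ≥0∞) (η : Ω' → List ℕ → List ℕ → ℕ → ℝ≥0∞),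
      IsSelfReinforcedBranching δ E μ →
      (∀ w, IsEdgeBranching δ (fun ω => η ω w) μ') → iIndepFun (fun w ω => η ω w) μ' →
      IdentDistrib (fun ω (t : ℝ≥0) => selfReinforcedTree (E ω) t)
        (fun ω (t : ℝ≥0) => nestedTree (η ω) t) μ μ') ∧
    -- the limiting degree
    (∀ (Ω : Type u) (Ω' : Type v) [MeasurableSpace Ω] [MeasurableSpace Ω']
      (μ : Measure Ω) (μ' : Measure Ω') [IsProbabilityMeasure μ] [IsProbabilityMeasure μ']
      (E : Ω → ℕ → ℝ≥0∞) (ξ : Ω' → List ℕ → ℕ → ℝ≥0∞) (T : Ω → ℝ≥0) (T' : Ω' → ℝ≥0),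
      IsSelfReinforcedInterarrival δ E μ → IsEdgeBranching δ ξ μ' →
      HasLaw (fun ω => (T ω : ℝ)) (expMeasure 1) μ →
      HasLaw (fun ω => (T' ω : ℝ)) (expMeasure 1) μ' →
      IndepFun T E μ → IndepFun T' (fun ω => birthTime (ξ ω)) μ' →
      (∀ k : ℕ, 1 ≤ k → μ {ω | offspringCount (E ω) (T ω) + 1 = k} =
        μ {ω | arrivalTime (E ω) (k - 1) ≤ T ω ∧ T ω < arrivalTime (E ω) k}) ∧
      IdentDistrib (fun ω => offspringCount (E ω) (T ω) + 1)
        (fun ω => populationSize (ξ ω) (T' ω)) μ μ') := by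
  refine ⟨?_, ?_, ?_⟩
  · intro Ω Ω' _ _ μ μ' _ _ E ξ hE hξ
    exact identDistrib_offspringCount hδ hE hξ
  · intro Ω Ω' _ _ μ μ' _ _ E η hE hη hind
    have hηm : ∀ w, Measurable fun ω => η ω w := fun w => (hη w).isPoissonBranching.measurable
    have h1 : ∀ w, IdentDistrib (fun ω k => arrivalTime (E ω w) (k + 1))
        (fun ω k => successiveBirthTime (η ω w) k) μ μ' := fun w => by
      -- Applying `levelTime` to both counting processes transfers their equality in law to the ages
      -- at the births. Independence over the individuals then gives the joint law, and the family
      -- tree is a measurable function of all ages.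
      have := (identDistrib_offspringCount hδ (hE.offspring w) (hη w)).comp
        measurable_levelTime
      simpa only [Function.comp_def, levelTime_offspringCount, levelTime_populationSize] using this
    have h2 := IdentDistrib.pi h1
      (hE.indep.comp (fun _ e k => arrivalTime e (k + 1))
        fun _ => measurable_pi_iff.2 fun k => measurable_arrivalTime (k + 1))
      (hind.comp (fun _ ξ k => successiveBirthTime ξ k) fun _ => measurable_successiveBirthTime)
    exact h2.comp measurable_population
  · intro Ω Ω' _ _ μ μ' _ _ E ξ T T' hE hξ hT hT' hTE hTξ
    refine ⟨fun k hk => ?_, ?_⟩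
    · obtain ⟨k, rfl⟩ := Nat.exists_eq_add_of_le' hk
      congr 1
      ext ω
      simpa using offspringCount_add_one_eq_iff (E ω) (T ω) k
    · have hT1 : AEMeasurable T μ := by simpa using hT.aemeasurable.real_toNNReal
      have hT2 : AEMeasurable T' μ' := by simpa using hT'.aemeasurable.real_toNNReal
      have hTT : IdentDistrib T T' μ μ' := by
        have : IdentDistrib (fun ω => (T ω : ℝ)) (fun ω => (T' ω : ℝ)) μ μ' :=
          ⟨hT.aemeasurable, hT'.aemeasurable, hT.map_eq.trans hT'.map_eq.symm⟩
        simpa [Function.comp_def] using this.comp measurable_real_toNNReal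
      have hA : Measurable fun ω i => arrivalTime (E ω) i :=
        measurable_pi_iff.2 fun i => (measurable_arrivalTime i).comp hE.measurable
      have hB : Measurable fun ω => birthTime (ξ ω) := measurable_pi_iff.2 fun w =>
        (measurable_birthTime w).comp hξ.isPoissonBranching.measurable
      have hTA : IndepFun T (fun ω i => arrivalTime (E ω) i) μ :=
        hTE.comp measurable_id (measurable_pi_iff.2 fun i => measurable_arrivalTime i)
      have h1 := identDistrib_offspringCount hδ hE hξ
      simp_rw [offspringCount_add_one] at h1 ⊢
      exact identDistrib_encard_le_random hA hB hTT hTA hTξ h1
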